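/- Consider the massless scalar free field on two-dimensional Minkowski spacetime $\mathbb R^2\ni x=(x^0,x^1)$. For $m\ge 0$, $p\in\mathbb R$ and real test functions $f,g\in\mathcal D_{\mathbb R}(\mathbb R^2)$ put $\omega_m(p)=\sqrt{p^2+m^2}$, $\hat f_m(p)=\int f(x)\,e^{i(\omega_m(p)x^0-p\,x^1)}\,d^2x$, $q_f=\int f(x)\,d^2x$ (the charge), and, for $m>0$, $$w_m(f,g)=\frac1{2\pi}\int_{\mathbb R}\frac{dp}{2\omega_m(p)}\,\overline{\hat f_m(p)}\,\hat g_m(p),\qquad D_0(f,g)=\lim_{m\to0}\big(w_m(f,g)-w_m(g,f)\big).$$ Let $\mathcal F$ be the Weyl $C^*$-algebra over $\mathcal D_{\mathbb R}(\mathbb R^2)/\Box\mathcal D_{\mathbb R}(\mathbb R^2)$ generated by the operators $W(f)$, $f\in\mathcal D_{\mathbb R}(\mathbb R^2)$, with $W(f)W(g)=e^{-D_0(f,g)/2}W(f+g)$ and $W(f)^*=W(-f)$. Let $\langle\,\cdot\,\rangle$ be the vacuum state, $\langle W(f)\rangle=\lim_{m\to0}e^{-\frac12w_m(f,f)}$ (which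 is $0$ if $q_f\ne0$), let $(\pi,\mathcal H,\Omega)$ be its GNS representation, and let $U(a)$, $a\in\mathbb R^2$, be the unitaries on $\mathcal H$ implementing the translations, $U(a)\pi(W(f))\Omega=\pi(W(f_a))\Omega$ with $f_a(x)=f(x-a)$. Let $\mathcal A\subset\mathcal F$ be the $C^*$-subalgebra generated by all $W(f)$ with $q_f=0$, let $\mathcal H_0=\overline{\pi(\mathcal A)\Omega}$, and for $\lambda\in\{1,-1\}$ let $\mathcal H_\lambda=\{\Psi\in\mathcal H:\ U(t,\lambda t)\Psi=\Psi\ \text{for all } t\in\mathbb R\}$. Then for each $\lambda\in\{1,-1\}$: 1. $\mathcal H_\lambda\subset\mathcal H_0$. 2. Single-wave vectors have zero charge: every $\Psi\in\mathcal H_\lambda$ is orthogonal to $\pi(W(f))\Omega$ for every $f\in\mathcal D_{\mathbb R}(\mathbb R^2)$ with $q_f\neq0$. 3. Let $f,g\in\mathcal D_{\mathbb R}(\mathbb R^2)$. If $q_f+q_g\ne0$, then $\langle\Omega,\pi(W(g))\pi(W(f_{(t,\lambda t)}))\Omega\rangle=0$ for all $t\in\mathbb R$. If $q_f+q_g=0$,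 then, as $t\to\pm\infty$, $|\langle\Omega,\pi(W(g))\pi(W(f_{(t,\lambda t)}))\Omega\rangle|$ is bounded above and below by positive constants (depending on $f,g,\lambda$) times $|t|^{q_fq_g/(4\pi)}$; in particular it decays like the power $|t|^{-q_f^2/(4\pi)}$ if $q_f=-q_g\neq0$. -/

import Mathlib

open MeasureTheory Filter Topology
open scoped Distributions LineDeriv ComplexConjugate ComplexOrder InnerProductSpace

noncomputable section

namespace MasslessField

/-- Two-dimensional Minkowski spacetime; `x.1` is the time and `x.2` the space coordinate. -/
abbrev Spacetime : Type := ℝ × ℝ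

/-- Real-valued smooth compactly supported functions on spacetime. -/
abbrev TestFn : Type := 𝓓((⊤ : TopologicalSpace.Opens Spacetime), ℝ)

/-- The charge of a test function, its integral over spacetime. -/
def charge (f : TestFn) : ℝ := ∫ x, f x

/-- The energy `√(p² + m²)` of a particle of mass `m` and momentum `p`. -/
def energy (m p : ℝ) : ℝ := √(p ^ 2 + m ^ 2)

/-- `∫ f(x) exp(i p·x) d²x` on the mass shell, where `p·x = ω x⁰ - p x¹` with `ω = √(p² + m²)`. -/
def shellFourier (m p : ℝ) (f : TestFn) : ℂ :=
  ∫ x : Spacetime, (f x : ℂ) * Complex.exp (((energy m p * x.1 - p * x.2 : ℝ) : ℂ) * Complex.I)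

/-- The two-point function of the free field of mass `m`, smeared with real test functions. It is
the distribution `w_m(x - y) = (2π)⁻¹ ∫ dp / (2 ω_m(p)) exp(- i p·(x - y))` integrated against
`f(x) g(y)`. -/
def twoPoint (m : ℝ) (f g : TestFn) : ℂ :=
  (2 * Real.pi : ℂ)⁻¹ *
    ∫ p : ℝ, (conj (shellFourier m p f) * shellFourier m p g) / (2 * energy m p : ℂ)

/-- The commutator function of the massless field, the limit `m → 0` of `w_m(x) - w_m(-x)`,
smeared with two test functions. -/
def commutator (f g : TestFn) : ℂ :=
  limUnder (𝓝[>] (0 : ℝ)) fun m => twoPoint m f g - twoPoint m g f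

/-- The vacuum expectation value of the Weyl operator `W(f)` of the massless field:
the limit `m → 0` of `exp(- w_m(f, f) / 2)`. -/
def vacuumValue (f : TestFn) : ℂ :=
  limUnder (𝓝[>] (0 : ℝ)) fun m => Complex.exp (-(twoPoint m f f) / 2)

/-- The d'Alembertian `∂₀² - ∂₁²`. -/
def box : TestFn →ₗ[ℝ] TestFn where
  toFun f := ∂_{((1, 0) : Spacetime)} (∂_{((1, 0) : Spacetime)} f) -
    ∂_{((0, 1) : Spacetime)} (∂_{((0, 1) : Spacetime)} f)
  map_add' f g := by
    simp only [LineDeriv.lineDerivOp_add]; abel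
  map_smul' c f := by
    simp only [LineDeriv.lineDerivOp_smul, RingHom.id_apply, smul_sub]

/-! ### Estimates on the mass shell -/

lemma energy_nonneg (m p : ℝ) : 0 ≤ energy m p := Real.sqrt_nonneg _

lemma abs_le_energy (m p : ℝ) : |p| ≤ energy m p := by
  rw [energy, ← Real.sqrt_sq_eq_abs]; exact Real.sqrt_le_sqrt (by nlinarith [sq_nonneg m])

lemma mass_le_energy (m p : ℝ) : |m| ≤ energy m p := by
  rw [energy, ← Real.sqrt_sq_eq_abs]; exact Real.sqrt_le_sqrt (by nlinarith [sq_nonneg p])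

lemma energy_zero (p : ℝ) : energy 0 p = |p| := by
  simp [energy, Real.sqrt_sq_eq_abs]

lemma energy_le (m p : ℝ) : energy m p ≤ |p| + |m| := by
  rw [energy]
  apply Real.sqrt_le_iff.2 ⟨by positivity, ?_⟩
  nlinarith [sq_abs p, sq_abs m, abs_nonneg p, abs_nonneg m, mul_nonneg (abs_nonneg p) (abs_nonneg m)]

lemma continuous_energy : Continuous fun q : ℝ × ℝ => energy q.1 q.2 := by
  unfold energy; fun_prop

lemma testFn_integrable (f : TestFn) : Integrable (fun x : Spacetime => f x) :=
  f.continuous.integrable_of_hasCompactSupport f.hasCompactSupport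

lemma shell_integrable (m p : ℝ) (f : TestFn) : Integrable fun x : Spacetime =>
    (f x : ℂ) * Complex.exp (((energy m p * x.1 - p * x.2 : ℝ) : ℂ) * Complex.I) := by
  refine (Continuous.mul (Complex.continuous_ofReal.comp f.continuous)
    (by fun_prop)).integrable_of_hasCompactSupport ?_
  exact HasCompactSupport.mul_right (f.hasCompactSupport.comp_left (g := fun r : ℝ => (r : ℂ)) (by simp))

lemma norm_shell_le (m p : ℝ) (f : TestFn) : ‖shellFourier m p f‖ ≤ ∫ x, ‖f x‖ := by
  refine (norm_integral_le_integral_norm _).trans (le_of_eq ?_)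
  congr 1; ext x
  rw [norm_mul, Complex.norm_exp_ofReal_mul_I]; simp

lemma shell_add (m p : ℝ) (f g : TestFn) :
    shellFourier m p (f + g) = shellFourier m p f + shellFourier m p g := by
  unfold shellFourier
  rw [← integral_add (shell_integrable m p f) (shell_integrable m p g)]
  congr 1; ext x; simp [add_mul]

lemma shell_smul (m p c : ℝ) (f : TestFn) :
    shellFourier m p (c • f) = c * shellFourier m p f := by
  unfold shellFourier
  rw [← integral_const_mul]
  congr 1; ext x; simp [mul_assoc]

lemma shell_sub (m p : ℝ) (f g : TestFn) :
    shellFourier m p (f - g) = shellFourier m p f - shellFourier m p g := by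
  have := shell_add m p (f - g) g
  rw [sub_add_cancel] at this; rw [this]; ring

lemma charge_add (f g : TestFn) : charge (f + g) = charge f + charge g := by
  unfold charge
  rw [← integral_add (testFn_integrable f) (testFn_integrable g)]; rfl

lemma charge_smul (c : ℝ) (f : TestFn) : charge (c • f) = c * charge f := by
  unfold charge; rw [← integral_const_mul]; rfl

lemma charge_sub (f g : TestFn) : charge (f - g) = charge f - charge g := by
  have := charge_add (f - g) g
  rw [sub_add_cancel] at this; linarith

lemma shell_deriv (m p : ℝ) (f : TestFn) (v : Spacetime) :
    shellFourier m p (∂_{v} f) =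
      -(((energy m p * v.1 - p * v.2 : ℝ) : ℂ) * Complex.I) * shellFourier m p f := by
  set L : Spacetime →L[ℝ] ℂ :=
    (Complex.ofRealCLM.comp (energy m p • ContinuousLinearMap.fst ℝ ℝ ℝ -
      p • ContinuousLinearMap.snd ℝ ℝ ℝ)).smulRight Complex.I with hL
  have hLx : ∀ x : Spacetime, L x = ((energy m p * x.1 - p * x.2 : ℝ) : ℂ) * Complex.I := by
    intro x; simp [hL]
  have hg : ∀ x : Spacetime, HasFDerivAt (fun x => Complex.exp (L x)) (Complex.exp (L x) • L) x :=
    fun x => L.hasFDerivAt.cexp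
  have hf : ∀ x : Spacetime, HasFDerivAt (fun x => (f x : ℂ))
      (Complex.ofRealCLM.comp (fderiv ℝ f x)) x := fun x =>
    Complex.ofRealCLM.hasFDerivAt.comp x
      ((f.contDiff.differentiable (by simp)).differentiableAt).hasFDerivAt
  have hd : ∀ x, (∂_{v} f) x = fderiv ℝ f x v := by
    intro x
    rw [TestFunction.lineDerivOp_eq_lineDerivCLM ℝ, TestFunction.lineDerivCLM_eq_fderivCLM]
    simp
  have key := integral_bilinear_hasFDerivAt_right_eq_neg_left_of_integrable (μ := volume)
    (B := ContinuousLinearMap.mul ℝ ℂ) (v := v)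
    (f := fun x => (f x : ℂ)) (f' := fun x => Complex.ofRealCLM.comp (fderiv ℝ f x))
    (g := fun x => Complex.exp (L x)) (g' := fun x => Complex.exp (L x) • L)
    (by simpa [← hd, hLx] using shell_integrable m p (∂_{v} f))
    (by
      have := (shell_integrable m p f).mul_const (L v)
      refine this.congr (ae_of_all _ fun x => ?_)
      simp [hLx, mul_assoc])
    (by simpa [hLx] using shell_integrable m p f)
    (fun x _ => hf x) (fun x _ => hg x)
  have e1 : shellFourier m p (∂_{v} f) = ∫ x : Spacetime, ((ContinuousLinearMap.mul ℝ ℂ)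
      ((Complex.ofRealCLM.comp (fderiv ℝ f x)) v)) (Complex.exp (L x)) := by
    unfold shellFourier; congr 1
  have e2 : (∫ x : Spacetime, ((ContinuousLinearMap.mul ℝ ℂ) (f x : ℂ))
      ((Complex.exp (L x) • L) v)) = L v * shellFourier m p f := by
    unfold shellFourier; rw [← integral_const_mul]; congr 1; ext x; simp [hLx]; ring
  rw [e1, ← hLx v, neg_mul, ← e2, key, neg_neg]

lemma shell_box_zero (p : ℝ) (f : TestFn) : shellFourier 0 p (box f) = 0 := by
  change shellFourier 0 p (_ - _) = 0
  rw [shell_sub]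
  simp only [shell_deriv, energy_zero]
  have : ((|p| : ℝ) : ℂ) ^ 2 = (p : ℂ) ^ 2 := by rw [← Complex.ofReal_pow, sq_abs]; push_cast; ring
  push_cast
  linear_combination (Complex.I ^ 2 * shellFourier 0 p f) * this

lemma charge_eq_shell (f : TestFn) : (charge f : ℂ) = shellFourier 0 0 f := by
  unfold charge shellFourier; rw [← integral_complex_ofReal]; simp [energy]

lemma charge_box (f : TestFn) : charge (box f) = 0 := by
  exact_mod_cast (charge_eq_shell (box f)).trans (shell_box_zero 0 f)

lemma continuous_shell (f : TestFn) : Continuous fun q : ℝ × ℝ => shellFourier q.1 q.2 f := by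
  unfold shellFourier
  refine continuous_of_dominated (bound := fun x => ‖f x‖) (fun q => ?_) (fun q => ?_) 
    (testFn_integrable f).norm ?_
  · exact (shell_integrable q.1 q.2 f).aestronglyMeasurable
  · refine ae_of_all _ fun x => ?_
    rw [norm_mul, Complex.norm_exp_ofReal_mul_I]; simp
  · refine ae_of_all _ fun x => ?_
    have := continuous_energy
    fun_prop

lemma exists_shell_decay (f : TestFn) :
    ∃ C : ℝ, 0 ≤ C ∧ ∀ m p, ‖shellFourier m p f‖ ≤ C ∧ |p| * ‖shellFourier m p f‖ ≤ C := by
  refine ⟨(∫ x, ‖f x‖) + ∫ x, ‖(∂_{((0, 1) : Spacetime)} f) x‖, by positivity, fun m p => ⟨?_, ?_⟩⟩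
  · exact (norm_shell_le m p f).trans (le_add_of_nonneg_right (by positivity))
  · have := norm_shell_le m p (∂_{((0, 1) : Spacetime)} f)
    rw [shell_deriv] at this
    simp at this
    exact this.trans (le_add_of_nonneg_left (by positivity))

lemma exists_shell_sub_charge (f : TestFn) :
    ∃ A : ℝ, 0 ≤ A ∧ ∀ m p, ‖shellFourier m p f - charge f‖ ≤ A * energy m p := by
  have hint : Integrable fun x : Spacetime => ‖f x‖ * (2 * ‖x‖) := by
    refine Continuous.integrable_of_hasCompactSupport ?_ ?_
    · have := f.continuous
      fun_prop
    · exact f.hasCompactSupport.norm.mul_right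
  refine ⟨∫ x : Spacetime, ‖f x‖ * (2 * ‖x‖), by positivity, fun m p => ?_⟩
  unfold charge
  rw [← integral_complex_ofReal]
  unfold shellFourier
  have hfi : Integrable fun x : Spacetime => (f x : ℂ) := (testFn_integrable f).ofReal
  rw [← integral_sub (shell_integrable m p f) hfi, mul_comm,
    ← integral_const_mul]
  refine norm_integral_le_of_norm_le (hint.const_mul _) (ae_of_all _ fun x => ?_)
  have e : (f x : ℂ) * Complex.exp (((energy m p * x.1 - p * x.2 : ℝ) : ℂ) * Complex.I) - (f x : ℂ)
      = (f x : ℂ) * (Complex.exp (Complex.I * ((energy m p * x.1 - p * x.2 : ℝ) : ℂ)) - 1) := by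
    rw [mul_comm Complex.I]; ring
  have h1 := Real.norm_exp_I_mul_ofReal_sub_one_le (x := energy m p * x.1 - p * x.2)
  have h2 : ‖energy m p * x.1 - p * x.2‖ ≤ energy m p * (2 * ‖x‖) := by
    have a1 : |x.1| ≤ ‖x‖ := norm_fst_le x
    have a2 : |x.2| ≤ ‖x‖ := norm_snd_le x
    have e0 := energy_nonneg m p
    calc ‖energy m p * x.1 - p * x.2‖ ≤ ‖energy m p * x.1‖ + ‖p * x.2‖ := norm_sub_le _ _
      _ = energy m p * |x.1| + |p| * |x.2| := by
        simp [abs_of_nonneg e0]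
      _ ≤ energy m p * ‖x‖ + energy m p * ‖x‖ := by
        gcongr; exact abs_le_energy m p
      _ = _ := by ring
  rw [e, norm_mul, Complex.norm_real]
  calc ‖f x‖ * _ ≤ ‖f x‖ * (energy m p * (2 * ‖x‖)) := by gcongr; exact h1.trans h2
    _ = _ := by ring

/-- `|p|`-integrable majorants: the product of two shell transforms. -/
lemma exists_pair_bound (f g : TestFn) : ∃ K : ℝ, 0 ≤ K ∧ ∀ m p,
    ‖conj (shellFourier m p f) * shellFourier m p g‖ ≤ K * (1 + p ^ 2)⁻¹ ∧
    ‖conj (shellFourier m p f) * shellFourier m p g - charge f * charge g‖ ≤ K * energy m p := by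
  obtain ⟨C, hC0, hC⟩ := exists_shell_decay f
  obtain ⟨C', hC0', hC'⟩ := exists_shell_decay g
  obtain ⟨A, hA0, hA⟩ := exists_shell_sub_charge f
  obtain ⟨B, hB0, hB⟩ := exists_shell_sub_charge g
  refine ⟨2 * C * C' + (C * B + A * |charge g|), by positivity, fun m p => ⟨?_, ?_⟩⟩
  · obtain ⟨h1, h2⟩ := hC m p
    obtain ⟨h3, h4⟩ := hC' m p
    rw [norm_mul, RCLike.norm_conj, ← div_eq_mul_inv, le_div_iff₀ (by positivity)]
    set a := ‖shellFourier m p f‖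
    set b := ‖shellFourier m p g‖
    have ha : 0 ≤ a := norm_nonneg _
    have hb : 0 ≤ b := norm_nonneg _
    have : a * b ≤ C * C' := mul_le_mul h1 h3 hb hC0
    have h5 : (|p| * a) * (|p| * b) ≤ C * C' := mul_le_mul h2 h4 (by positivity) hC0
    have h6 : a * b * (1 + p ^ 2) = a * b + (|p| * a) * (|p| * b) := by
      rw [← sq_abs p]; ring
    have : 0 ≤ C * B + A * |charge g| := by positivity
    rw [h6]; linarith
  · have e : conj (shellFourier m p f) * shellFourier m p g - charge f * charge g =
        conj (shellFourier m p f) * (shellFourier m p g - charge g) +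
        conj (shellFourier m p f - charge f) * charge g := by
      simp [map_sub]; ring
    rw [e]
    have e0 := energy_nonneg m p
    calc _ ≤ ‖conj (shellFourier m p f) * (shellFourier m p g - charge g)‖ +
        ‖conj (shellFourier m p f - charge f) * charge g‖ := norm_add_le _ _
      _ = ‖shellFourier m p f‖ * ‖shellFourier m p g - charge g‖ +
        ‖shellFourier m p f - charge f‖ * |charge g| := by
          rw [norm_mul, norm_mul, RCLike.norm_conj, RCLike.norm_conj, Complex.norm_real,
            Real.norm_eq_abs]
      _ ≤ C * (B * energy m p) + A * energy m p * |charge g| := by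
          gcongr
          · exact (hC m p).1
          · exact hB m p
          · exact hA m p
      _ = (C * B + A * |charge g|) * energy m p := by ring
      _ ≤ _ := by
          have : 0 ≤ 2 * C * C' := by positivity
          exact mul_le_mul_of_nonneg_right (by linarith) e0

lemma inv_sq_integrable (K : ℝ) : Integrable fun p : ℝ => K * (1 + p ^ 2)⁻¹ :=
  integrable_inv_one_add_sq.const_mul K

/-- The massless limit of integrals over the mass shell whose numerator vanishes at zero
momentum. -/
lemma massless_limit (G : ℝ → ℝ → ℂ) (hG : Continuous fun q : ℝ × ℝ => G q.1 q.2) (K : ℝ)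
    (h1 : ∀ m p, ‖G m p‖ ≤ K * (1 + p ^ 2)⁻¹) (h2 : ∀ m p, ‖G m p‖ ≤ K * energy m p) :
    (∀ m, Integrable fun p : ℝ => G m p / (2 * energy m p : ℂ)) ∧
    Tendsto (fun m => ∫ p : ℝ, G m p / (2 * energy m p : ℂ)) (𝓝 0)
      (𝓝 (∫ p : ℝ, G 0 p / (2 * energy 0 p : ℂ))) := by
  have hK : 0 ≤ K := by
    have := (norm_nonneg _).trans (h1 0 0); simpa using this
  have hmeas : ∀ m, AEStronglyMeasurable (fun p : ℝ => G m p / (2 * energy m p : ℂ)) volume := by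
    intro m
    have c1 : Continuous fun p : ℝ => G m p := hG.comp (by fun_prop : Continuous fun p : ℝ => (m, p))
    have c2 : Continuous fun p : ℝ => energy m p :=
      continuous_energy.comp (by fun_prop : Continuous fun p : ℝ => (m, p))
    have c3 : Measurable fun p : ℝ => G m p / (2 * energy m p : ℂ) :=
      c1.measurable.div (by have := c2.measurable; fun_prop)
    exact c3.aestronglyMeasurable
  have hb : ∀ m p, ‖G m p / (2 * energy m p : ℂ)‖ ≤ K * (1 + p ^ 2)⁻¹ := by
    intro m p
    have e0 := energy_nonneg m p
    have hn : ‖(2 * energy m p : ℂ)‖ = 2 * energy m p := by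
      rw [norm_mul, Complex.norm_real, Real.norm_eq_abs, abs_of_nonneg e0]; simp
    rw [norm_div, hn]
    rcases e0.eq_or_lt with h0 | h0
    · rw [← h0]; simp; positivity
    rw [div_le_iff₀ (by positivity)]
    rcases le_total 1 |p| with hp | hp
    · have : 1 ≤ 2 * energy m p := by linarith [abs_le_energy m p]
      exact (h1 m p).trans (le_mul_of_one_le_right (by positivity) this)
    · have h3 : (1 : ℝ) ≤ (1 + p ^ 2)⁻¹ * 2 := by
        rw [← div_eq_inv_mul, le_div_iff₀ (by positivity), ← sq_abs]
        nlinarith [abs_nonneg p]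
      calc ‖G m p‖ ≤ K * energy m p * 1 := by simpa using h2 m p
        _ ≤ K * energy m p * ((1 + p ^ 2)⁻¹ * 2) := by gcongr
        _ = _ := by ring
  refine ⟨fun m => (inv_sq_integrable K).mono' (hmeas m) (ae_of_all _ (hb m)), ?_⟩
  refine tendsto_integral_filter_of_dominated_convergence (fun p => K * (1 + p ^ 2)⁻¹)
    (Eventually.of_forall hmeas) (Eventually.of_forall fun m => ae_of_all _ (hb m))
    (inv_sq_integrable K) ?_
  have : ∀ᵐ p : ℝ, p ≠ 0 := by simp [ae_iff]
  filter_upwards [this] with p hp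
  have c1 : Continuous fun m : ℝ => G m p := hG.comp (by fun_prop : Continuous fun m : ℝ => (m, p))
  have c2 : Continuous fun m : ℝ => energy m p :=
    continuous_energy.comp (by fun_prop : Continuous fun m : ℝ => (m, p))
  refine Tendsto.div c1.continuousAt.tendsto ?_ ?_
  · exact (by fun_prop : Continuous fun m : ℝ => (2 * energy m p : ℂ)).continuousAt.tendsto
  · rw [energy_zero]; simpa using hp

/-! ### The massless limits -/

lemma continuous_pair (f g : TestFn) : Continuous fun q : ℝ × ℝ =>
    conj (shellFourier q.1 q.2 f) * shellFourier q.1 q.2 g := by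
  have h1 := continuous_shell f
  have h2 := continuous_shell g
  exact (Complex.continuous_conj.comp h1).mul h2

lemma twoPoint_integrable {m : ℝ} (hm : m ≠ 0) (f g : TestFn) : Integrable fun p : ℝ =>
    (conj (shellFourier m p f) * shellFourier m p g) / (2 * energy m p : ℂ) := by
  obtain ⟨K, hK, hb⟩ := exists_pair_bound f g
  have hpos : 0 < |m| := abs_pos.2 hm
  have c0 : Continuous fun p : ℝ => (m, p) := by fun_prop
  have c1 := (continuous_pair f g).comp c0
  have c2 := continuous_energy.comp c0
  simp only [Function.comp_def] at c1 c2
  have c3 : Measurable fun p : ℝ =>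
      (conj (shellFourier m p f) * shellFourier m p g) / (2 * energy m p : ℂ) :=
    c1.measurable.div (by have := c2.measurable; fun_prop)
  refine (inv_sq_integrable (K / (2 * |m|))).mono' c3.aestronglyMeasurable (ae_of_all _ fun p => ?_)
  have e0 := energy_nonneg m p
  have hn : ‖(2 * energy m p : ℂ)‖ = 2 * energy m p := by
    rw [norm_mul, Complex.norm_real, Real.norm_eq_abs, abs_of_nonneg e0]; simp
  rw [norm_div, hn, div_mul_eq_mul_div]
  exact div_le_div₀ (by positivity) (hb m p).1 (by positivity)
    (by linarith [mass_le_energy m p])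

lemma twoPoint_conj (m : ℝ) (f g : TestFn) : conj (twoPoint m f g) = twoPoint m g f := by
  unfold twoPoint
  rw [map_mul, ← integral_conj]
  congr 1
  · simp [map_ofNat]
  · congr 1; ext p; simp [mul_comm, map_ofNat]

/-- The commutator function as an integral over the massless shell. -/
def shellCommutator (f g : TestFn) : ℂ :=
  (2 * Real.pi : ℂ)⁻¹ * ∫ p : ℝ, (conj (shellFourier 0 p f) * shellFourier 0 p g -
    conj (shellFourier 0 p g) * shellFourier 0 p f) / (2 * energy 0 p : ℂ)

lemma commutator_aux (f g : TestFn) :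
    (∀ m, Integrable fun p : ℝ => (conj (shellFourier m p f) * shellFourier m p g -
      conj (shellFourier m p g) * shellFourier m p f) / (2 * energy m p : ℂ)) ∧
    Tendsto (fun m => ∫ p : ℝ, (conj (shellFourier m p f) * shellFourier m p g -
      conj (shellFourier m p g) * shellFourier m p f) / (2 * energy m p : ℂ)) (𝓝 0)
      (𝓝 (∫ p : ℝ, (conj (shellFourier 0 p f) * shellFourier 0 p g -
        conj (shellFourier 0 p g) * shellFourier 0 p f) / (2 * energy 0 p : ℂ))) := by
  obtain ⟨K, hK, hb⟩ := exists_pair_bound f g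
  obtain ⟨K', hK', hb'⟩ := exists_pair_bound g f
  refine massless_limit (fun m p => conj (shellFourier m p f) * shellFourier m p g -
      conj (shellFourier m p g) * shellFourier m p f)
      ((continuous_pair f g).sub (continuous_pair g f)) (K + K') (fun m p => ?_) (fun m p => ?_)
  · exact (norm_sub_le _ _).trans (by linarith [(hb m p).1, (hb' m p).1])
  · have : conj (shellFourier m p f) * shellFourier m p g -
        conj (shellFourier m p g) * shellFourier m p f =
        (conj (shellFourier m p f) * shellFourier m p g - charge f * charge g) -
        (conj (shellFourier m p g) * shellFourier m p f - charge g * charge f) := by ring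
    rw [this]
    exact (norm_sub_le _ _).trans (by linarith [(hb m p).2, (hb' m p).2])

/-- The massless limit defining the commutator function exists. -/
theorem tendsto_commutator (f g : TestFn) :
    Tendsto (fun m => twoPoint m f g - twoPoint m g f) (𝓝[>] (0 : ℝ)) (𝓝 (commutator f g)) ∧
    commutator f g = shellCommutator f g := by
  have h : Tendsto (fun m => twoPoint m f g - twoPoint m g f) (𝓝[>] (0 : ℝ))
      (𝓝 (shellCommutator f g)) := by
    refine (((commutator_aux f g).2.mono_left nhdsWithin_le_nhds).const_mul
      (2 * Real.pi : ℂ)⁻¹).congr' ?_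
    filter_upwards [self_mem_nhdsWithin] with m hm
    have hm' : m ≠ 0 := (Set.mem_Ioi.1 hm).ne'
    unfold twoPoint
    rw [← mul_sub, ← integral_sub (twoPoint_integrable hm' f g) (twoPoint_integrable hm' g f)]
    congr 2; ext p; rw [sub_div]
  have h' : commutator f g = shellCommutator f g := h.limUnder_eq
  exact ⟨h' ▸ h, h'⟩

lemma commutator_add_left (f f' g : TestFn) :
    commutator (f + f') g = commutator f g + commutator f' g := by
  simp only [(tendsto_commutator _ _).2]
  unfold shellCommutator
  rw [← mul_add, ← integral_add ((commutator_aux f g).1 0) ((commutator_aux f' g).1 0)]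
  congr 2; ext p; simp only [shell_add, map_add]; ring

lemma commutator_smul_left (c : ℝ) (f g : TestFn) :
    commutator (c • f) g = c • commutator f g := by
  simp only [(tendsto_commutator _ _).2]
  unfold shellCommutator
  rw [Complex.real_smul, mul_left_comm]
  congr 1
  rw [← integral_const_mul]
  congr 1 with p
  simp only [shell_smul, map_mul, Complex.conj_ofReal]; ring

lemma commutator_swap (f g : TestFn) : commutator f g = -commutator g f := by
  simp only [(tendsto_commutator _ _).2]
  unfold shellCommutator
  rw [← mul_neg, ← integral_neg]
  congr 2 with p
  ring

lemma commutator_conj (f g : TestFn) : conj (commutator f g) = -commutator f g := by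
  rw [← commutator_swap]
  refine tendsto_nhds_unique ((Complex.continuous_conj.tendsto _).comp (tendsto_commutator f g).1) ?_
  refine (tendsto_commutator g f).1.congr fun m => ?_
  simp [twoPoint_conj]

lemma commutator_box_left (f g : TestFn) : commutator (box f) g = 0 := by
  rw [(tendsto_commutator _ _).2]
  simp [shellCommutator, shell_box_zero]

lemma commutator_add_right (f g g' : TestFn) :
    commutator f (g + g') = commutator f g + commutator f g' := by
  rw [commutator_swap, commutator_add_left, commutator_swap g, commutator_swap g']; ring

lemma commutator_smul_right (c : ℝ) (f g : TestFn) :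
    commutator f (c • g) = c • commutator f g := by
  rw [commutator_swap, commutator_smul_left, commutator_swap g, smul_neg, neg_neg]

lemma twoPoint_re_lower (f : TestFn) : ∃ K : ℝ, ∀ m : ℝ, 0 < m →
    charge f ^ 2 / 2 * Real.log ((1 + m) / m) - K ≤ 2 * Real.pi * (twoPoint m f f).re := by
  obtain ⟨K, hK, hb⟩ := exists_pair_bound f f
  refine ⟨K / 2, fun m hm => ?_⟩
  have hI := twoPoint_integrable hm.ne' f f
  have e1 : 2 * Real.pi * (twoPoint m f f).re =
      ∫ p : ℝ, ‖shellFourier m p f‖ ^ 2 / (2 * energy m p) := by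
    have : twoPoint m f f = (((2 * Real.pi)⁻¹ *
        ∫ p : ℝ, ‖shellFourier m p f‖ ^ 2 / (2 * energy m p) : ℝ) : ℂ) := by
      unfold twoPoint
      push_cast
      rw [← integral_complex_ofReal]
      congr 2; ext p; rw [Complex.conj_mul']; push_cast; rfl
    rw [this, Complex.ofReal_re, ← mul_assoc, mul_inv_cancel₀ (by positivity), one_mul]
  have hI' : Integrable fun p : ℝ => ‖shellFourier m p f‖ ^ 2 / (2 * energy m p) := by
    refine hI.norm.congr (ae_of_all _ fun p => ?_)
    have e0 := energy_nonneg m p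
    simp [abs_of_nonneg e0, sq]
  have hnn : ∀ p, 0 ≤ ‖shellFourier m p f‖ ^ 2 / (2 * energy m p) := fun p => by
    have e0 := energy_nonneg m p
    positivity
  have hlow : ∀ p ∈ Set.Icc (0 : ℝ) 1,
      charge f ^ 2 / 2 * (p + m)⁻¹ - K / 2 ≤ ‖shellFourier m p f‖ ^ 2 / (2 * energy m p) := by
    intro p hp
    have hep : 0 < energy m p := lt_of_lt_of_le (abs_pos.2 hm.ne') (mass_le_energy m p)
    have hle : energy m p ≤ p + m := by
      simpa [abs_of_nonneg hp.1, abs_of_pos hm] using energy_le m p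
    have h2 := (hb m p).2
    have h3 : charge f ^ 2 - K * energy m p ≤ ‖shellFourier m p f‖ ^ 2 := by
      have : conj (shellFourier m p f) * shellFourier m p f - charge f * charge f =
        ((‖shellFourier m p f‖ ^ 2 - charge f ^ 2 : ℝ) : ℂ) := by
        rw [Complex.conj_mul']; push_cast; ring
      rw [this, Complex.norm_real] at h2
      linarith [(abs_le.1 h2).1]
    have h4 : (p + m)⁻¹ ≤ (energy m p)⁻¹ := inv_anti₀ hep hle
    have h5 : charge f ^ 2 / 2 * (p + m)⁻¹ ≤ charge f ^ 2 / 2 * (energy m p)⁻¹ := by gcongr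
    have h6 : charge f ^ 2 / 2 * (energy m p)⁻¹ - K / 2 =
      (charge f ^ 2 - K * energy m p) / (2 * energy m p) := by field_simp
    have h7 : (charge f ^ 2 - K * energy m p) / (2 * energy m p) ≤
      ‖shellFourier m p f‖ ^ 2 / (2 * energy m p) := by gcongr
    linarith
  have hcont : ContinuousOn (fun p : ℝ => (p + m)⁻¹) (Set.uIcc 0 1) := by
    refine ContinuousOn.inv₀ (by fun_prop) fun p hp => ?_
    rw [Set.uIcc_of_le zero_le_one] at hp
    linarith [hp.1]
  have hii : IntervalIntegrable (fun p : ℝ => (p + m)⁻¹) volume 0 1 := hcont.intervalIntegrable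
  have e2 : ∫ p in (0 : ℝ)..1, (charge f ^ 2 / 2 * (p + m)⁻¹ - K / 2) =
      charge f ^ 2 / 2 * Real.log ((1 + m) / m) - K / 2 := by
    rw [intervalIntegral.integral_sub (hii.const_mul _) (by simp),
      intervalIntegral.integral_const_mul, intervalIntegral.integral_comp_add_right (fun p => p⁻¹),
      integral_inv_of_pos (by linarith) (by linarith)]
    simp
  rw [e1, ← e2]
  calc _ ≤ ∫ p in (0 : ℝ)..1, ‖shellFourier m p f‖ ^ 2 / (2 * energy m p) :=
        intervalIntegral.integral_mono_on zero_le_one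
          ((hii.const_mul _).sub (by simp)) hI'.intervalIntegrable hlow
    _ ≤ _ := by
        rw [intervalIntegral.integral_of_le zero_le_one]
        exact setIntegral_le_integral hI' (ae_of_all _ hnn)

/-- The massless limit defining the vacuum expectation values exists; it vanishes for charged
test functions and for neutral ones it is given by the massless two-point function. -/
theorem tendsto_vacuumValue (f : TestFn) :
    Tendsto (fun m => Complex.exp (-(twoPoint m f f) / 2)) (𝓝[>] (0 : ℝ)) (𝓝 (vacuumValue f)) ∧
    vacuumValue f = if charge f = 0 then Complex.exp (-(twoPoint 0 f f) / 2) else 0 := by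
  have h : Tendsto (fun m => Complex.exp (-(twoPoint m f f) / 2)) (𝓝[>] (0 : ℝ))
      (𝓝 (if charge f = 0 then Complex.exp (-(twoPoint 0 f f) / 2) else 0)) := by
    split_ifs with hq
    · obtain ⟨K, hK, hb⟩ := exists_pair_bound f f
      have := (massless_limit (fun m p => conj (shellFourier m p f) * shellFourier m p f)
        (continuous_pair f f) K (fun m p => (hb m p).1)
        (fun m p => by simpa [hq] using (hb m p).2)).2.mono_left
          (nhdsWithin_le_nhds (s := Set.Ioi (0 : ℝ)))
      have h2 : Tendsto (fun m => twoPoint m f f) (𝓝[>] (0 : ℝ)) (𝓝 (twoPoint 0 f f)) :=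
        this.const_mul _
      exact (Complex.continuous_exp.tendsto _).comp (h2.neg.div_const 2)
    · obtain ⟨K, hK⟩ := twoPoint_re_lower f
      rw [tendsto_zero_iff_norm_tendsto_zero]
      have hlog : Tendsto (fun m : ℝ => Real.log ((1 + m) / m)) (𝓝[>] (0 : ℝ)) atTop := by
        refine Real.tendsto_log_atTop.comp ?_
        have : Tendsto (fun m : ℝ => m⁻¹ + 1) (𝓝[>] (0 : ℝ)) atTop :=
          tendsto_atTop_add_const_right _ _ tendsto_inv_nhdsGT_zero
        refine this.congr' ?_
        filter_upwards [self_mem_nhdsWithin] with m hm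
        have : m ≠ 0 := (Set.mem_Ioi.1 hm).ne'
        field_simp
      have hq2 : 0 < charge f ^ 2 / 2 := by positivity
      have h1 : Tendsto (fun m : ℝ => charge f ^ 2 / 2 * Real.log ((1 + m) / m) - K)
          (𝓝[>] (0 : ℝ)) atTop :=
        tendsto_atTop_add_const_right _ _ (hlog.const_mul_atTop hq2)
      have h2 : Tendsto (fun m : ℝ => 2 * Real.pi * (twoPoint m f f).re) (𝓝[>] (0 : ℝ)) atTop := by
        refine tendsto_atTop_mono' _ ?_ h1
        filter_upwards [self_mem_nhdsWithin] with m hm using hK m hm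
      have h3 : Tendsto (fun m : ℝ => (4 * Real.pi)⁻¹ * (2 * Real.pi * (twoPoint m f f).re))
          (𝓝[>] (0 : ℝ)) atTop := h2.const_mul_atTop (by positivity)
      refine (Real.tendsto_exp_neg_atTop_nhds_zero.comp h3).congr fun m => ?_
      rw [Complex.norm_exp]
      simp only [Function.comp]
      congr 1
      have : (-(twoPoint m f f) / 2).re = -((twoPoint m f f).re / 2) := by
        rw [neg_div, Complex.neg_re]; simp
      rw [this]
      field_simp
      norm_num
  have h' := h.limUnder_eq
  change vacuumValue f = _ at h'
  exact ⟨h' ▸ h, h'⟩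

lemma vacuumValue_congr {f g : TestFn} (hF : ∀ p, shellFourier 0 p f = shellFourier 0 p g) :
    vacuumValue f = vacuumValue g := by
  have hq : charge f = charge g := by
    exact_mod_cast (charge_eq_shell f).trans ((hF 0).trans (charge_eq_shell g).symm)
  rw [(tendsto_vacuumValue f).2, (tendsto_vacuumValue g).2, hq]
  simp [twoPoint, hF]

lemma vacuumValue_zero : vacuumValue 0 = 1 := by
  rw [(tendsto_vacuumValue 0).2]
  simp [charge, twoPoint, shellFourier]

/-! ### Positivity -/

section PosSemidef
open Matrix

lemma posSemidef_limit {ι X : Type*} {l : Filter X} [l.NeBot] {M : X → Matrix ι ι ℂ}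
    {N : Matrix ι ι ℂ} (hM : ∀ᶠ x in l, (M x).PosSemidef)
    (h : ∀ i j, Tendsto (fun x => M x i j) l (𝓝 (N i j))) : N.PosSemidef := by
  refine ⟨?_, fun v => ?_⟩
  · ext i j
    rw [conjTranspose_apply]
    refine tendsto_nhds_unique ((continuous_star.tendsto _).comp (h j i)) ((h i j).congr' ?_)
    filter_upwards [hM] with x hx
    exact (hx.1.apply i j).symm
  · have : Tendsto (fun x => v.sum fun i xi => v.sum fun j xj => star xi * M x i j * xj) l
        (𝓝 (v.sum fun i xi => v.sum fun j xj => star xi * N i j * xj)) := by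
      simp only [Finsupp.sum]
      exact tendsto_finsetSum _ fun i _ => tendsto_finsetSum _ fun j _ =>
        ((h i j).const_mul _).mul_const _
    refine ge_of_tendsto this ?_
    filter_upwards [hM] with x hx using hx.2 v

lemma posSemidef_ones (ι : Type*) : (Matrix.of fun _ _ : ι => (1 : ℂ)).PosSemidef := by
  refine ⟨by ext; simp, fun v => ?_⟩
  have : (v.sum fun i xi => v.sum fun j xj => star xi * (1 : ℂ) * xj) =
      star (v.sum fun _ xj => xj) * v.sum fun _ xj => xj := by
    simp [Finsupp.sum, Finset.sum_mul_sum]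
  simp only [of_apply]
  rw [this]; exact star_mul_self_nonneg _

lemma posSemidef_exp {ι : Type*} {M : Matrix ι ι ℂ} (hM : M.PosSemidef) :
    (Matrix.of fun i j => Complex.exp (M i j)).PosSemidef := by
  have hpow : ∀ n : ℕ, (Matrix.of fun i j => M i j ^ n).PosSemidef := by
    intro n
    induction n with
    | zero => simpa using posSemidef_ones ι
    | succ n ih =>
      have e : (Matrix.of fun i j => M i j ^ (n + 1)) = (Matrix.of fun i j => M i j ^ n) ⊙ M := by
        ext i j; simp [pow_succ]
      rw [e]
      exact ih.hadamard hM
  have hsum : ∀ n : ℕ, (Matrix.of fun i j =>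
      ∑ k ∈ Finset.range n, M i j ^ k / (k.factorial : ℂ)).PosSemidef := by
    intro n
    induction n with
    | zero =>
      have e : (Matrix.of fun i j => ∑ k ∈ Finset.range 0, M i j ^ k / (k.factorial : ℂ)) = 0 := by
        ext i j; simp
      rw [e]
      exact Matrix.PosSemidef.zero
    | succ n ih =>
      have h1 : (0 : ℂ) ≤ ((n.factorial : ℂ))⁻¹ := by
        have : (0 : ℝ) ≤ ((n.factorial : ℝ))⁻¹ := by positivity
        have h2 := Complex.zero_le_real.2 this
        push_cast at h2
        exact h2
      have e : (Matrix.of fun i j => ∑ k ∈ Finset.range (n + 1), M i j ^ k / (k.factorial : ℂ)) =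
          (Matrix.of fun i j => ∑ k ∈ Finset.range n, M i j ^ k / (k.factorial : ℂ)) +
            ((n.factorial : ℂ))⁻¹ • (Matrix.of fun i j => M i j ^ n) := by
        ext i j; simp [Finset.sum_range_succ, div_eq_inv_mul]
      rw [e]
      exact ih.add ((hpow n).smul h1)
  refine posSemidef_limit (l := atTop) (Eventually.of_forall hsum) fun i j => ?_
  have := (NormedSpace.expSeries_div_hasSum_exp (𝔸 := ℂ) (M i j)).tendsto_sum_nat
  rw [← Complex.exp_eq_exp_ℂ] at this
  exact this

lemma posSemidef_conj_diag {ι : Type*} {M : Matrix ι ι ℂ} (hM : M.PosSemidef) (d : ι → ℂ) :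
    (Matrix.of fun i j => star (d i) * M i j * d j).PosSemidef := by
  have h1 : (Matrix.of fun i j => star (d i) * d j).PosSemidef := by
    refine ⟨by ext i j; simp [mul_comm], fun v => ?_⟩
    have : (v.sum fun i xi => v.sum fun j xj => star xi * (star (d i) * d j) * xj) =
        star (v.sum fun i xi => d i * xi) * v.sum fun j xj => d j * xj := by
      simp only [Finsupp.sum, star_sum, Finset.sum_mul_sum, star_mul']
      refine Finset.sum_congr rfl fun i _ => Finset.sum_congr rfl fun j _ => by ring
    simp only [of_apply]
    rw [this]; exact star_mul_self_nonneg _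
  have e : (Matrix.of fun i j => star (d i) * M i j * d j) =
      (Matrix.of fun i j => star (d i) * d j) ⊙ M := by
    ext i j; simp; ring
  rw [e]
  exact h1.hadamard hM

lemma posSemidef_twoPoint {m : ℝ} (hm : m ≠ 0) :
    (Matrix.of fun f g : TestFn => twoPoint m f g).PosSemidef := by
  refine ⟨by ext f g; simpa using twoPoint_conj m g f, fun v => ?_⟩
  simp only [of_apply]
  have e : (v.sum fun f a => v.sum fun g b => star a * twoPoint m f g * b) =
      (((2 * Real.pi)⁻¹ * ∫ p : ℝ,
        ‖v.sum fun f a => a * shellFourier m p f‖ ^ 2 / (2 * energy m p) : ℝ) : ℂ) := by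
    push_cast
    rw [← integral_complex_ofReal]
    have : ∀ p : ℝ, ((‖v.sum fun f a => a * shellFourier m p f‖ ^ 2 / (2 * energy m p) : ℝ) : ℂ) =
        ∑ f ∈ v.support, ∑ g ∈ v.support, star (v f) * v g *
          ((conj (shellFourier m p f) * shellFourier m p g) / (2 * energy m p : ℂ)) := by
      intro p
      push_cast
      rw [← Complex.conj_mul']
      simp only [Finsupp.sum, map_sum, Finset.sum_mul_sum, Finset.sum_div]
      refine Finset.sum_congr rfl fun f _ => Finset.sum_congr rfl fun g _ => ?_
      simp; ring
    simp only [this]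
    rw [integral_finsetSum _ fun f _ => integrable_finsetSum _ fun g _ =>
      (twoPoint_integrable hm f g).const_mul _]
    simp only [Finsupp.sum, Finset.mul_sum]
    refine Finset.sum_congr rfl fun f _ => ?_
    rw [integral_finsetSum _ fun g _ => (twoPoint_integrable hm f g).const_mul _, Finset.mul_sum]
    refine Finset.sum_congr rfl fun g _ => ?_
    rw [integral_const_mul]
    unfold twoPoint; ring
  rw [e, Complex.zero_le_real]
  refine mul_nonneg (by positivity) (integral_nonneg fun p => ?_)
  have := energy_nonneg m p
  positivity

lemma twoPoint_sub {m : ℝ} (hm : m ≠ 0) (f g : TestFn) : twoPoint m (f - g) (f - g) =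
    twoPoint m f f + twoPoint m g g - twoPoint m f g - twoPoint m g f := by
  have h1 := twoPoint_integrable hm f f
  have h2 := twoPoint_integrable hm g g
  have h3 := twoPoint_integrable hm f g
  have h4 := twoPoint_integrable hm g f
  unfold twoPoint
  have h12 := h1.add h2
  have h123 := h12.sub h3
  simp only [Pi.add_def, Pi.sub_def] at h12 h123
  rw [← mul_add, ← mul_sub, ← mul_sub, ← integral_add h1 h2, ← integral_sub h12 h3,
    ← integral_sub h123 h4]
  congr 1
  refine integral_congr_ae (ae_of_all _ fun p => ?_)
  simp only [shell_sub, map_sub]; ring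

/-- Positivity of the vacuum functional on the Weyl operators:
the matrix of the values of `W(f)⋆ W(g)` is positive semidefinite. -/
theorem posSemidef_vacuum :
    (Matrix.of fun f g : TestFn => vacuumValue (f - g) * Complex.exp (commutator f g / 2)).PosSemidef := by
  refine posSemidef_limit (l := 𝓝[>] (0 : ℝ)) (M := fun m => Matrix.of fun f g : TestFn =>
    star (Complex.exp (-(twoPoint m f f) / 2)) * Complex.exp (twoPoint m f g) *
      Complex.exp (-(twoPoint m g g) / 2)) ?_ fun f g => ?_
  · filter_upwards [self_mem_nhdsWithin] with m hm
    exact posSemidef_conj_diag (posSemidef_exp (posSemidef_twoPoint (Set.mem_Ioi.1 hm).ne'))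
      (fun f => Complex.exp (-(twoPoint m f f) / 2))
  · have h1 := (tendsto_vacuumValue (f - g)).1.mul
      ((Complex.continuous_exp.tendsto _).comp ((tendsto_commutator f g).1.div_const 2))
    refine h1.congr' ?_
    filter_upwards [self_mem_nhdsWithin] with m hm
    have hc : conj (twoPoint m f f) = twoPoint m f f := twoPoint_conj m f f
    have hs : star (Complex.exp (-(twoPoint m f f) / 2)) = Complex.exp (-(twoPoint m f f) / 2) := by
      rw [Complex.star_def, ← Complex.exp_conj]; simp [hc, map_ofNat]
    simp only [of_apply, Function.comp]
    rw [hs, ← Complex.exp_add, ← Complex.exp_add, ← Complex.exp_add,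
      twoPoint_sub (Set.mem_Ioi.1 hm).ne']
    congr 1; ring

end PosSemidef

/-! ### Translations of test functions -/

/-- The translated test function `x ↦ f (x - a)`. -/
def translate (a : Spacetime) : TestFn →ₗ[ℝ] TestFn where
  toFun f :=
    { toFun := fun x => f (x - a)
      contDiff' := f.contDiff.comp (by fun_prop)
      hasCompactSupport' := f.hasCompactSupport.comp_homeomorph (Homeomorph.subRight a)
      tsupport_subset' := fun _ _ => trivial }
  map_add' _ _ := rfl
  map_smul' _ _ := rfl

lemma translate_apply (a x : Spacetime) (f : TestFn) : translate a f x = f (x - a) := rfl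

lemma translate_add (a b : Spacetime) (f : TestFn) :
    translate (a + b) f = translate a (translate b f) := by
  ext x; simp only [translate_apply, sub_sub]

lemma translate_zero (f : TestFn) : translate 0 f = f := by
  ext x; simp [translate_apply]

lemma lineDeriv_translate (a v : Spacetime) (f : TestFn) :
    ∂_{v} (translate a f) = translate a (∂_{v} f) := by
  ext x
  rw [translate_apply, TestFunction.lineDerivOp_eq_lineDerivCLM ℝ,
    TestFunction.lineDerivOp_eq_lineDerivCLM ℝ, TestFunction.lineDerivCLM_eq_fderivCLM,
    TestFunction.lineDerivCLM_eq_fderivCLM]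
  simp only [TestFunction.fderivCLM_apply, le_refl, top_add, if_true]
  change fderiv ℝ (fun x => f (x - a)) x v = _
  rw [fderiv_comp_sub]

lemma box_translate (a : Spacetime) (f : TestFn) : box (translate a f) = translate a (box f) := by
  change _ - _ = translate a (_ - _)
  rw [map_sub]; simp only [lineDeriv_translate]

lemma shell_translate (m p : ℝ) (a : Spacetime) (f : TestFn) :
    shellFourier m p (translate a f) =
      Complex.exp (((energy m p * a.1 - p * a.2 : ℝ) : ℂ) * Complex.I) * shellFourier m p f := by
  have e := integral_sub_right_eq_self (μ := volume) (fun x : Spacetime =>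
    Complex.exp (((energy m p * a.1 - p * a.2 : ℝ) : ℂ) * Complex.I) * ((f x : ℂ) *
      Complex.exp (((energy m p * x.1 - p * x.2 : ℝ) : ℂ) * Complex.I))) a
  unfold shellFourier
  rw [← integral_const_mul, ← e]
  congr 1 with x
  rw [translate_apply, mul_left_comm, ← Complex.exp_add, ← add_mul, ← Complex.ofReal_add]
  congr 4
  simp only [Prod.fst_sub, Prod.snd_sub]; ring

lemma pair_translate (m p : ℝ) (a : Spacetime) (f g : TestFn) :
    conj (shellFourier m p (translate a f)) * shellFourier m p (translate a g) =
      conj (shellFourier m p f) * shellFourier m p g := by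
  rw [shell_translate, shell_translate, map_mul, mul_mul_mul_comm, Complex.conj_mul',
    Complex.norm_exp_ofReal_mul_I]
  simp

lemma twoPoint_translate (m : ℝ) (a : Spacetime) (f g : TestFn) :
    twoPoint m (translate a f) (translate a g) = twoPoint m f g := by
  unfold twoPoint; simp only [pair_translate]

lemma commutator_translate (a : Spacetime) (f g : TestFn) :
    commutator (translate a f) (translate a g) = commutator f g := by
  unfold commutator; simp only [twoPoint_translate]

lemma vacuumValue_translate (a : Spacetime) (f : TestFn) :
    vacuumValue (translate a f) = vacuumValue f := by
  unfold vacuumValue; simp only [twoPoint_translate]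

/-! ### The symplectic space -/

/-- The space of test functions modulo the image of the d'Alembertian. -/
abbrev FieldSpace : Type := TestFn ⧸ LinearMap.range box

/-- The commutator function as a bilinear form on the field space. -/
def form : FieldSpace →ₗ[ℝ] FieldSpace →ₗ[ℝ] ℂ :=
  Submodule.liftQ _
    (LinearMap.flip (Submodule.liftQ _
      (LinearMap.mk₂ ℝ (fun g f => commutator f g) (fun _ _ _ => commutator_add_right _ _ _)
        (fun _ _ _ => commutator_smul_right _ _ _) (fun _ _ _ => commutator_add_left _ _ _)
        (fun _ _ _ => commutator_smul_left _ _ _)) (by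
          rintro _ ⟨h, rfl⟩
          rw [LinearMap.mem_ker]; ext f
          simp [commutator_swap f, commutator_box_left])))
    (by
      rintro _ ⟨h, rfl⟩
      rw [LinearMap.mem_ker]
      refine LinearMap.ext fun g => ?_
      obtain ⟨g, rfl⟩ := Submodule.mkQ_surjective _ g
      simp [commutator_box_left])

/-- The class of a test function in the field space. -/
def toField : TestFn →ₗ[ℝ] FieldSpace := Submodule.mkQ _

lemma toField_surjective : Function.Surjective toField := Submodule.mkQ_surjective _

@[simp] lemma form_toField (f g : TestFn) : form (toField f) (toField g) = commutator f g := rfl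

lemma form_swap (f g : FieldSpace) : form f g = -form g f := by
  obtain ⟨f, rfl⟩ := toField_surjective f
  obtain ⟨g, rfl⟩ := toField_surjective g
  exact commutator_swap f g

lemma form_self (f : FieldSpace) : form f f = 0 := by
  have := form_swap f f
  exact self_eq_neg.1 this

lemma form_conj (f g : FieldSpace) : conj (form f g) = -form f g := by
  obtain ⟨f, rfl⟩ := toField_surjective f
  obtain ⟨g, rfl⟩ := toField_surjective g
  exact commutator_conj f g

lemma norm_exp_form (f g : FieldSpace) : ‖Complex.exp (-(form f g) / 2)‖ = 1 := by
  have h : (form f g).re = 0 := by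
    have := congrArg Complex.re (form_conj f g)
    rw [Complex.conj_re, Complex.neg_re] at this
    linarith
  rw [Complex.norm_exp, neg_div, Complex.neg_re]
  simp [h]

/-- Translations on the field space. -/
def translateField (a : Spacetime) : FieldSpace →ₗ[ℝ] FieldSpace :=
  Submodule.mapQ _ _ (translate a) (by
    rintro _ ⟨h, rfl⟩
    exact ⟨translate a h, box_translate a h⟩)

@[simp] lemma translateField_toField (a : Spacetime) (f : TestFn) :
    translateField a (toField f) = toField (translate a f) := rfl

lemma translateField_add (a b : Spacetime) (f : FieldSpace) :
    translateField (a + b) f = translateField a (translateField b f) := by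
  obtain ⟨f, rfl⟩ := toField_surjective f
  simp [translate_add]

lemma translateField_zero (f : FieldSpace) : translateField 0 f = f := by
  obtain ⟨f, rfl⟩ := toField_surjective f
  simp [translate_zero]

lemma form_translateField (a : Spacetime) (f g : FieldSpace) :
    form (translateField a f) (translateField a g) = form f g := by
  obtain ⟨f, rfl⟩ := toField_surjective f
  obtain ⟨g, rfl⟩ := toField_surjective g
  exact commutator_translate a f g

/-- Translation by `a` as a permutation of the field space. -/
def translatePerm (a : Spacetime) : FieldSpace ≃ FieldSpace where
  toFun := translateField a
  invFun := translateField (-a)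
  left_inv f := by rw [← translateField_add]; simp [translateField_zero]
  right_inv f := by rw [← translateField_add]; simp [translateField_zero]

/-! ### The Weyl algebra -/

/-- The Hilbert space of square summable families indexed by the field space. -/
abbrev WeylSpace : Type := lp (fun _ : FieldSpace => ℂ) 2

lemma memlp_weighted (e : FieldSpace ≃ FieldSpace) (c : FieldSpace → ℂ) (hc : ∀ i, ‖c i‖ = 1)
    (ψ : WeylSpace) : Memℓp (fun i => c i * ψ (e i)) 2 := by
  have h0 : 0 < (2 : ENNReal).toReal := by norm_num
  have h := (lp.memℓp ψ).summable h0
  rw [memℓp_gen_iff h0]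
  refine (e.summable_iff.2 h).congr fun i => ?_
  simp [hc]

/-- The unitary operator `ψ ↦ (i ↦ c i * ψ (e⁻¹ i))` on the space of square summable families. -/
def weightedPerm (e : FieldSpace ≃ FieldSpace) (c : FieldSpace → ℂ) (hc : ∀ i, ‖c i‖ = 1) :
    WeylSpace ≃ₗᵢ[ℂ] WeylSpace where
  toFun ψ := ⟨fun i => c i * ψ (e.symm i), memlp_weighted e.symm c hc ψ⟩
  invFun ψ := ⟨fun i => conj (c (e i)) * ψ (e i),
    memlp_weighted e (fun i => conj (c (e i))) (fun i => by simp [hc]) ψ⟩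
  map_add' ψ φ := by ext i; exact mul_add _ _ _
  map_smul' z ψ := by ext i; simp [mul_left_comm]
  left_inv ψ := by
    ext i; simp [← mul_assoc, Complex.conj_mul', hc]
  right_inv ψ := by
    ext i; simp [← mul_assoc, Complex.mul_conj', hc]
  norm_map' ψ := by
    have h0 : 0 < (2 : ENNReal).toReal := by norm_num
    rw [lp.norm_eq_tsum_rpow h0, lp.norm_eq_tsum_rpow h0, ← e.symm.tsum_eq (fun i => ‖ψ i‖ ^ (2 : ENNReal).toReal)]
    congr 2 with i
    simp [hc]

lemma weightedPerm_apply (e : FieldSpace ≃ FieldSpace) (c : FieldSpace → ℂ) (hc : ∀ i, ‖c i‖ = 1)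
    (ψ : WeylSpace) (i : FieldSpace) : weightedPerm e c hc ψ i = c i * ψ (e.symm i) := rfl

/-- The unitary operator attached to a class `f` of test functions:
it maps `ψ` to `g ↦ exp(- D₀(f, g) / 2) ψ (g - f)`. -/
def weylUnitary (f : FieldSpace) : unitary (WeylSpace →L[ℂ] WeylSpace) :=
  Unitary.linearIsometryEquiv.symm
    (weightedPerm (Equiv.addLeft f) (fun g => Complex.exp (-(form f g) / 2)) (norm_exp_form f))

/-- The Weyl operator attached to a class of test functions. -/
def weylOp (f : FieldSpace) : WeylSpace →L[ℂ] WeylSpace := weylUnitary f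

lemma weylOp_apply (f : FieldSpace) (ψ : WeylSpace) (g : FieldSpace) :
    weylOp f ψ g = Complex.exp (-(form f g) / 2) * ψ (g - f) := by
  change Complex.exp (-(form f g) / 2) * ψ ((Equiv.addLeft f).symm g) = _
  simp [neg_add_eq_sub]

lemma weylOp_mul (f g : FieldSpace) :
    weylOp f * weylOp g = Complex.exp (-(form f g) / 2) • weylOp (f + g) := by
  ext ψ i
  change weylOp f (weylOp g ψ) i = Complex.exp (-(form f g) / 2) * weylOp (f + g) ψ i
  simp only [weylOp_apply, ← mul_assoc, ← Complex.exp_add, map_sub, form_swap g f, map_add,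
    LinearMap.add_apply]
  congr 2
  · ring
  · abel_nf

lemma weylOp_zero : weylOp 0 = 1 := by
  ext ψ i
  change weylOp 0 ψ i = ψ i
  simp [weylOp_apply]

lemma star_weylOp (f : FieldSpace) : star (weylOp f) = weylOp (-f) := by
  have h1 : weylOp f * weylOp (-f) = 1 := by
    rw [weylOp_mul]; simp [form_self, weylOp_zero]
  have h2 : star (weylOp f) * weylOp f = 1 := (weylUnitary f).2.1
  calc star (weylOp f) = star (weylOp f) * (weylOp f * weylOp (-f)) := by rw [h1, mul_one]
    _ = weylOp (-f) := by rw [← mul_assoc, h2, one_mul]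

/-- The `C*`-algebra of operators generated by the Weyl operators. -/
def weylSubalgebra : StarSubalgebra ℂ (WeylSpace →L[ℂ] WeylSpace) :=
  (StarAlgebra.adjoin ℂ (Set.range weylOp)).topologicalClosure

/-- The `C*`-algebra `𝓕` generated by the Weyl operators `W(f)`. -/
def WeylAlgebra : Type := weylSubalgebra

instance : IsClosed (weylSubalgebra : Set (WeylSpace →L[ℂ] WeylSpace)) :=
  StarSubalgebra.isClosed_topologicalClosure _

instance : CStarAlgebra WeylAlgebra := inferInstanceAs (CStarAlgebra weylSubalgebra)

instance : PartialOrder WeylAlgebra := CStarAlgebra.spectralOrder WeylAlgebra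

instance : StarOrderedRing WeylAlgebra := CStarAlgebra.spectralOrderedRing WeylAlgebra

/-- The inclusion of the Weyl algebra into the bounded operators. -/
def WeylAlgebra.incl : WeylAlgebra →⋆ₐ[ℂ] (WeylSpace →L[ℂ] WeylSpace) := weylSubalgebra.subtype

lemma WeylAlgebra.incl_injective : Function.Injective WeylAlgebra.incl := Subtype.val_injective

lemma WeylAlgebra.isometry_incl : Isometry WeylAlgebra.incl := fun _ _ => rfl

lemma weylOp_mem (f : FieldSpace) : weylOp f ∈ weylSubalgebra :=
  StarSubalgebra.le_topologicalClosure _ (StarAlgebra.subset_adjoin ℂ _ ⟨f, rfl⟩)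

/-- The Weyl operator `W(f)` of a test function. -/
def weyl (f : TestFn) : WeylAlgebra := ⟨weylOp (toField f), weylOp_mem _⟩

@[simp] lemma incl_weyl (f : TestFn) : WeylAlgebra.incl (weyl f) = weylOp (toField f) := rfl

/-- The Weyl relations. -/
theorem weyl_mul (f g : TestFn) :
    weyl f * weyl g = Complex.exp (-(commutator f g) / 2) • weyl (f + g) := by
  apply WeylAlgebra.incl_injective
  rw [map_mul, map_smul]
  simp [weylOp_mul]

theorem star_weyl (f : TestFn) : star (weyl f) = weyl (-f) := by
  apply WeylAlgebra.incl_injective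
  rw [map_star]
  simp [star_weylOp]

theorem weyl_zero : weyl 0 = 1 := by
  apply WeylAlgebra.incl_injective
  simp [weylOp_zero]

/-- The linear combinations of Weyl operators are dense in the Weyl algebra. -/
theorem dense_span_weyl : Dense (Submodule.span ℂ (Set.range weyl) : Set WeylAlgebra) := by
  have hadj : (StarAlgebra.adjoin ℂ (Set.range weylOp) : Set (WeylSpace →L[ℂ] WeylSpace)) ⊆
      Submodule.span ℂ (Set.range weylOp) := by
    intro x hx
    induction hx using StarAlgebra.adjoin_induction with
    | mem x hx => exact Submodule.subset_span hx
    | algebraMap r =>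
      rw [Algebra.algebraMap_eq_smul_one, ← weylOp_zero]
      exact Submodule.smul_mem _ _ (Submodule.subset_span ⟨0, rfl⟩)
    | add x y _ _ hx hy => exact Submodule.add_mem _ hx hy
    | mul x y _ _ hx hy =>
      have := Submodule.mul_mem_mul hx hy
      rw [Submodule.span_mul_span] at this
      refine Submodule.span_le.2 ?_ this
      rintro _ ⟨_, ⟨f, rfl⟩, _, ⟨g, rfl⟩, rfl⟩
      change weylOp f * weylOp g ∈ _
      rw [weylOp_mul]
      exact Submodule.smul_mem _ _ (Submodule.subset_span ⟨_, rfl⟩)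
    | star x hx0 hx =>
      clear hx0
      induction hx using Submodule.span_induction with
      | mem x hx =>
        obtain ⟨f, rfl⟩ := hx
        rw [star_weylOp]; exact Submodule.subset_span ⟨_, rfl⟩
      | zero => simp
      | add x y _ _ hx hy => rw [star_add]; exact Submodule.add_mem _ hx hy
      | smul c x _ hx => rw [star_smul]; exact Submodule.smul_mem _ _ hx
  intro x
  have hx : WeylAlgebra.incl x ∈
      closure (Submodule.span ℂ (Set.range weylOp) : Set (WeylSpace →L[ℂ] WeylSpace)) :=
    closure_mono hadj x.2
  rw [WeylAlgebra.isometry_incl.isUniformInducing.isInducing.closure_eq_preimage_closure_image]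
  refine closure_mono ?_ hx
  intro y hy
  have hmap : Submodule.span ℂ (Set.range weylOp) ≤
      (Submodule.span ℂ (Set.range weyl)).map WeylAlgebra.incl.toAlgHom.toLinearMap := by
    rw [Submodule.span_le]
    rintro _ ⟨f, rfl⟩
    obtain ⟨f, rfl⟩ := toField_surjective f
    exact ⟨weyl f, Submodule.subset_span ⟨f, rfl⟩, rfl⟩
  obtain ⟨z, hz, rfl⟩ := hmap hy
  exact ⟨z, hz, rfl⟩

/-! ### The vacuum state -/

lemma vacuumValue_of_toField_eq {f g : TestFn} (h : toField f = toField g) :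
    vacuumValue f = vacuumValue g := by
  obtain ⟨k, hk⟩ := (Submodule.Quotient.eq (LinearMap.range box)).1 h
  refine vacuumValue_congr fun p => ?_
  have := shell_box_zero p k
  rw [hk, shell_sub] at this
  exact sub_eq_zero.1 this

/-- Almost invariant finite subsets of a commutative group. -/
lemma exists_almost_invariant {G : Type*} [AddCommGroup G] [DecidableEq G] (T : Finset G)
    (ε : ℝ) (hε : 0 < ε) : ∃ S : Finset G, S.Nonempty ∧ ∀ t ∈ T,
      (1 - ε) * (S.card : ℝ) ≤ ((S.filter fun g => g - t ∈ S).card : ℝ) := by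
  let c : ℕ → Finset (T → ℕ) := fun n => Fintype.piFinset fun _ => Finset.range n
  let σ : (T → ℕ) → G := fun k => ∑ t, k t • (t : G)
  let S : ℕ → Finset G := fun n => (c n).image σ
  have hcard : ∀ n, (S n).card ≤ n ^ T.card := fun n => by
    refine Finset.card_image_le.trans (le_of_eq ?_)
    simp [c]
  have hne : ∀ n, (S (n + 1)).Nonempty := fun n =>
    ⟨σ 0, Finset.mem_image_of_mem _ (by simp [c])⟩
  have hmono : ∀ n, S n ⊆ S (n + 1) := fun n => by
    refine Finset.image_subset_image fun k hk => ?_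
    simp only [c, Fintype.mem_piFinset, Finset.mem_range] at hk ⊢
    exact fun t => (hk t).trans (Nat.lt_succ_self n)
  have hshift : ∀ n, ∀ t ∈ T, ∀ g ∈ S n, g + t ∈ S (n + 1) := by
    intro n t ht g hg
    obtain ⟨k, hk, rfl⟩ := Finset.mem_image.1 hg
    refine Finset.mem_image.2 ⟨k + Pi.single ⟨t, ht⟩ 1, ?_, ?_⟩
    · simp only [c, Fintype.mem_piFinset, Finset.mem_range] at hk ⊢
      intro s
      have := hk s
      have h1 : (Pi.single (⟨t, ht⟩ : T) 1 : T → ℕ) s ≤ 1 := by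
        rw [Pi.single_apply]; split_ifs <;> simp
      simp only [Pi.add_apply]; omega
    · simp only [σ, Pi.add_apply, add_smul, Finset.sum_add_distrib]
      congr 1
      rw [Finset.sum_eq_single (⟨t, ht⟩ : T)] <;> simp +contextual
  obtain ⟨n, hn⟩ : ∃ n : ℕ, ((S (n + 2)).card : ℝ) ≤ (1 + ε) * ((S (n + 1)).card : ℝ) := by
    by_contra! hcon
    have hgrow : ∀ n : ℕ, (1 + ε) ^ n ≤ ((S (n + 1)).card : ℝ) := by
      intro n
      induction n with
      | zero => simpa using (hne 0).card_pos
      | succ n ih =>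
        rw [pow_succ']
        exact (mul_le_mul_of_nonneg_left ih (by positivity)).trans (hcon n).le
    have hlim := tendsto_pow_const_div_const_pow_of_one_lt T.card (r := 1 + ε) (by linarith)
    have hpos : 0 < (1 + ε)⁻¹ := by positivity
    obtain ⟨n, hn1, hn2⟩ := ((hlim.eventually (gt_mem_nhds hpos)).and (eventually_ge_atTop 1)).exists
    obtain ⟨k, rfl⟩ : ∃ k, n = k + 1 := ⟨n - 1, by omega⟩
    rw [div_lt_iff₀ (by positivity), pow_succ', ← mul_assoc, inv_mul_cancel₀ (by positivity),
      one_mul] at hn1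
    have h1 : ((S (k + 1)).card : ℝ) ≤ ((k + 1 : ℕ) : ℝ) ^ T.card := by exact_mod_cast hcard (k + 1)
    linarith [hgrow k]
  refine ⟨S (n + 1), hne n, fun t ht => ?_⟩
  set A := S (n + 1)
  have hB : (A.image (· + t)).card = A.card := Finset.card_image_of_injective _ (add_left_injective t)
  have hunion : (A ∪ A.image (· + t)).card ≤ (S (n + 2)).card := by
    refine Finset.card_le_card (Finset.union_subset (hmono _) fun g hg => ?_)
    obtain ⟨g', hg', rfl⟩ := Finset.mem_image.1 hg
    exact hshift _ t ht g' hg'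
  have hinter : A ∩ A.image (· + t) = A.filter fun g => g - t ∈ A := by
    ext g
    simp only [Finset.mem_inter, Finset.mem_image, Finset.mem_filter, and_congr_right_iff]
    exact fun _ => ⟨fun ⟨k, hk, e⟩ => by rw [← e]; simpa using hk, fun h => ⟨_, h, by simp⟩⟩
  have hsum := Finset.card_union_add_card_inter A (A.image (· + t))
  rw [hB, hinter] at hsum
  have hsum' : ((A ∪ A.image (· + t)).card : ℝ) + ((A.filter fun g => g - t ∈ A).card : ℝ) =
    A.card + A.card := by exact_mod_cast hsum
  have hunion' : ((A ∪ A.image (· + t)).card : ℝ) ≤ (S (n + 2)).card := by exact_mod_cast hunion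
  linarith

lemma nonneg_weylAlgebra {a : WeylAlgebra} (ha : 0 ≤ a) : ∃ b : WeylAlgebra, a = star b * b :=
  CStarAlgebra.nonneg_iff_eq_star_mul_self.1 ha

section Approximation
open Classical

/-- A set-theoretic choice of representatives. -/
def rep : FieldSpace → TestFn := Function.surjInv toField_surjective

lemma toField_rep (g : FieldSpace) : toField (rep g) = g := Function.surjInv_eq _ g

/-- The basis vectors of the space of square summable families. -/
def basisVec (g : FieldSpace) : WeylSpace := lp.single 2 g (1 : ℂ)

lemma inner_basisVec (g : FieldSpace) (ψ : WeylSpace) : inner ℂ (basisVec g) ψ = ψ g := by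
  simp [basisVec, lp.inner_single_left]

/-- The kernel of the vacuum functional. -/
def vacKernel (g h : FieldSpace) : ℂ :=
  vacuumValue (rep g - rep h) * Complex.exp (form g h / 2)

lemma posSemidef_vacKernel : (Matrix.of vacKernel).PosSemidef := by
  have := posSemidef_vacuum.submatrix rep
  convert this using 1
  ext g h
  simp only [Matrix.of_apply, Matrix.submatrix_apply, vacKernel]
  rw [← form_toField, toField_rep, toField_rep]

/-- Positive functionals approximating the vacuum state. -/
def approxFun (S : Finset FieldSpace) : (WeylSpace →L[ℂ] WeylSpace) →ₗ[ℂ] ℂ where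
  toFun T := (S.card : ℂ)⁻¹ * ∑ g ∈ S, ∑ h ∈ S, vacKernel g h * inner ℂ (basisVec g) (T (basisVec h))
  map_add' T T' := by
    simp [mul_add, Finset.sum_add_distrib]
  map_smul' c T := by
    simp only [smul_apply, inner_smul_right, RingHom.id_apply, smul_eq_mul,
      Finset.mul_sum]
    refine Finset.sum_congr rfl fun g _ => Finset.sum_congr rfl fun h _ => by ring

lemma posSemidef_inner (v : FieldSpace → WeylSpace) :
    (Matrix.of fun g h => (inner ℂ (v g) (v h) : ℂ)).PosSemidef := by
  refine ⟨by ext g h; simp [Matrix.conjTranspose_apply], fun x => ?_⟩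
  have e : (x.sum fun i xi => x.sum fun j xj => star xi * (inner ℂ (v i) (v j) : ℂ) * xj) =
      inner ℂ (x.sum fun i xi => xi • v i) (x.sum fun i xi => xi • v i) := by
    simp only [Finsupp.sum]
    rw [sum_inner]
    refine Finset.sum_congr rfl fun i _ => ?_
    rw [inner_sum]
    refine Finset.sum_congr rfl fun j _ => ?_
    rw [inner_smul_left, inner_smul_right, Complex.star_def]
    ring
  simp only [Matrix.of_apply]
  rw [e, inner_self_eq_norm_sq_to_K]
  have := Complex.zero_le_real.2 (sq_nonneg ‖x.sum fun i xi => xi • v i‖)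
  push_cast at this
  exact this

lemma approxFun_nonneg (S : Finset FieldSpace) (R : WeylSpace →L[ℂ] WeylSpace) :
    0 ≤ approxFun S (star R * R) := by
  have hG : (Matrix.of fun g h => inner ℂ (basisVec g) ((star R * R) (basisVec h))).PosSemidef := by
    have e : (Matrix.of fun g h => inner ℂ (basisVec g) ((star R * R) (basisVec h))) =
        Matrix.of fun g h => inner ℂ (R (basisVec g)) (R (basisVec h)) := by
      ext g h
      simp only [Matrix.of_apply]
      rw [← ContinuousLinearMap.adjoint_inner_right]
      rfl
    rw [e]
    exact posSemidef_inner _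
  have h := (posSemidef_vacKernel.hadamard hG).2 (Finsupp.indicator S fun _ _ => (1 : ℂ))
  rw [Finsupp.sum_of_support_subset _ (Finsupp.support_indicator_subset _ _) _ (by simp)] at h
  have h2 : (0 : ℂ) ≤ ((S.card : ℂ))⁻¹ := by
    have : (0 : ℝ) ≤ ((S.card : ℝ))⁻¹ := by positivity
    have := Complex.zero_le_real.2 this
    push_cast at this
    exact this
  refine mul_nonneg h2 (h.trans (le_of_eq ?_))
  refine Finset.sum_congr rfl fun g hg => ?_
  rw [Finsupp.sum_of_support_subset _ (Finsupp.support_indicator_subset _ _) _ (by simp)]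
  refine Finset.sum_congr rfl fun k hk => ?_
  simp [hg, hk]

lemma approxFun_weylOp (S : Finset FieldSpace) (f : TestFn) :
    approxFun S (weylOp (toField f)) =
      (((S.filter fun g => g - toField f ∈ S).card : ℝ) / (S.card : ℝ) : ℝ) * vacuumValue f := by
  have key : ∀ g ∈ S, (∑ h ∈ S, vacKernel g h *
      inner ℂ (basisVec g) (weylOp (toField f) (basisVec h))) =
      if g - toField f ∈ S then vacuumValue f else 0 := by
    intro g _
    have hterm : ∀ h, vacKernel g h * inner ℂ (basisVec g) (weylOp (toField f) (basisVec h)) =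
        if h = g - toField f then vacuumValue f else 0 := by
      intro h
      rw [inner_basisVec, weylOp_apply, basisVec]
      split_ifs with hh
      · subst hh
        rw [lp.single_apply_self, mul_one, vacKernel, mul_assoc, ← Complex.exp_add]
        have e1 : vacuumValue (rep g - rep (g - toField f)) = vacuumValue f :=
          vacuumValue_of_toField_eq (by simp [toField_rep])
        rw [e1, map_sub, form_self, form_swap (toField f) g]
        simp [sub_eq_add_neg, neg_div]
      · rw [lp.single_apply_ne _ _ _ (fun e => hh e.symm)]
        simp
    simp only [hterm, Finset.sum_ite_eq']
  change (S.card : ℂ)⁻¹ * _ = _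
  rw [Finset.sum_congr rfl key, ← Finset.sum_filter, Finset.sum_const]
  push_cast
  rw [nsmul_eq_mul]; ring

/-- The approximating functionals as positive functionals on the Weyl algebra. -/
def approxState (S : Finset FieldSpace) : WeylAlgebra →ₚ[ℂ] ℂ :=
  PositiveLinearMap.mk₀ ((approxFun S).comp WeylAlgebra.incl.toAlgHom.toLinearMap) (by
    intro a ha
    obtain ⟨b, rfl⟩ := nonneg_weylAlgebra ha
    change 0 ≤ approxFun S (WeylAlgebra.incl (star b * b))
    rw [map_mul, map_star]
    exact approxFun_nonneg S _)

lemma approxState_apply (S : Finset FieldSpace) (a : WeylAlgebra) :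
    approxState S a = approxFun S (WeylAlgebra.incl a) := rfl

lemma norm_approxState_le (S : Finset FieldSpace) (a : WeylAlgebra) :
    ‖approxState S a‖ ≤ 4 * ‖a‖ := by
  have h1 : ‖approxState S 1‖ ≤ 1 := by
    rw [← weyl_zero, approxState_apply, incl_weyl, approxFun_weylOp, vacuumValue_zero]
    simp only [map_zero, sub_zero, mul_one, Complex.norm_real]
    rw [Finset.filter_true_of_mem fun _ h => h, Real.norm_eq_abs, abs_of_nonneg (by positivity)]
    exact div_self_le_one _
  obtain ⟨y, hy0, hy1, hy⟩ := CStarAlgebra.exists_sum_four_nonneg a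
  conv_lhs => rw [hy]
  rw [map_sum]
  refine (norm_sum_le _ _).trans ?_
  have : ∀ i ∈ (Finset.univ : Finset (Fin 4)), ‖approxState S (Complex.I ^ (i : ℕ) • y i)‖ ≤ ‖a‖ := by
    intro i _
    rw [map_smul, norm_smul, norm_pow, Complex.norm_I, one_pow, one_mul]
    refine ((approxState S).norm_apply_le_of_nonneg (y i) (hy0 i)).trans ?_
    calc _ ≤ 1 * ‖a‖ := mul_le_mul h1 (hy1 i) (norm_nonneg _) zero_le_one
      _ = _ := one_mul _
  refine (Finset.sum_le_sum this).trans ?_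
  simp

/-- The vacuum functional extends to a positive functional on the Weyl algebra. -/
theorem exists_vacuumState :
    ∃ ω : WeylAlgebra →ₚ[ℂ] ℂ, ∀ f : TestFn, ω (weyl f) = vacuumValue f := by
  choose S hS using fun k : Finset FieldSpace × ℕ =>
    exists_almost_invariant k.1 (1 / ((k.2 : ℝ) + 1)) (by positivity)
  let U : Ultrafilter (Finset FieldSpace × ℕ) := Ultrafilter.of atTop
  have hU : (U : Filter (Finset FieldSpace × ℕ)) ≤ atTop := Ultrafilter.of_le _
  have hlim : ∀ a : WeylAlgebra, ∃ z : ℂ, Tendsto (fun k => approxState (S k) a) U (𝓝 z) := by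
    intro a
    obtain ⟨z, _, hz⟩ := (isCompact_closedBall (0 : ℂ) (4 * ‖a‖)).ultrafilter_le_nhds
      (U.map fun k => approxState (S k) a) (by
        rw [Ultrafilter.coe_map, le_principal_iff, mem_map]
        exact univ_mem' fun k => by simpa using norm_approxState_le (S k) a)
    exact ⟨z, hz⟩
  choose φ hφ using hlim
  let Φ : WeylAlgebra →ₗ[ℂ] ℂ :=
    { toFun := φ
      map_add' := fun a b => tendsto_nhds_unique (hφ (a + b))
        (((hφ a).add (hφ b)).congr fun k => by rw [map_add])
      map_smul' := fun c a => tendsto_nhds_unique (hφ (c • a))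
        (((hφ a).const_smul c).congr fun k => by rw [map_smul]) }
  refine ⟨PositiveLinearMap.mk₀ Φ fun a ha => ?_, fun f => ?_⟩
  · exact ge_of_tendsto (hφ a) (Eventually.of_forall fun k => (approxState (S k)).map_nonneg ha)
  · change φ (weyl f) = _
    refine tendsto_nhds_unique (hφ (weyl f)) (Tendsto.mono_left ?_ hU)
    simp only [approxState_apply, incl_weyl, approxFun_weylOp]
    have hr : Tendsto (fun k => (((S k).filter fun g => g - toField f ∈ S k).card : ℝ) /
        ((S k).card : ℝ)) atTop (𝓝 1) := by
      have h1 : Tendsto (fun k : Finset FieldSpace × ℕ => 1 - 1 / ((k.2 : ℝ) + 1)) atTop (𝓝 1) := by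
        have h2 : Tendsto (fun k : Finset FieldSpace × ℕ => k.2) atTop atTop := by
          rw [← prod_atTop_atTop_eq]; exact tendsto_snd
        simpa using (tendsto_one_div_add_atTop_nhds_zero_nat (𝕜 := ℝ)).comp h2 |>.const_sub 1
      refine tendsto_of_tendsto_of_tendsto_of_le_of_le' h1 tendsto_const_nhds ?_ ?_
      · filter_upwards [eventually_ge_atTop (({toField f} : Finset FieldSpace), 0)] with k hk
        have hc : (0 : ℝ) < (S k).card := by exact_mod_cast (hS k).1.card_pos
        rw [le_div_iff₀ hc]
        exact (hS k).2 _ (hk.1 (Finset.mem_singleton_self _))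
      · refine Eventually.of_forall fun k => div_le_one_of_le₀ ?_ (by positivity)
        exact_mod_cast Finset.card_filter_le _ _
    have := ((Complex.continuous_ofReal.tendsto 1).comp hr).mul_const (vacuumValue f)
    simpa using this

end Approximation

/-- The vacuum state of the massless free field: the positive functional on the Weyl algebra
with the values `ω(W(f)) = vacuumValue f`. -/
def vacuumState : WeylAlgebra →ₚ[ℂ] ℂ := exists_vacuumState.choose

theorem vacuumState_weyl (f : TestFn) : vacuumState (weyl f) = vacuumValue f :=
  exists_vacuumState.choose_spec f

lemma continuous_vacuumState : Continuous vacuumState := map_continuous vacuumState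

/-- The vacuum state is determined by its values on the Weyl operators. -/
theorem vacuumState_unique (ω : WeylAlgebra →ₚ[ℂ] ℂ)
    (h : ∀ f : TestFn, ω (weyl f) = vacuumValue f) : ω = vacuumState := by
  have hc : Continuous ω := map_continuous ω
  refine DFunLike.coe_injective (Continuous.ext_on dense_span_weyl hc continuous_vacuumState ?_)
  have : Set.EqOn (ω.toLinearMap) (vacuumState.toLinearMap)
      (Submodule.span ℂ (Set.range weyl)) := by
    refine LinearMap.eqOn_span ?_
    rintro _ ⟨f, rfl⟩
    exact (h f).trans (vacuumState_weyl f).symm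
  exact this

/-! ### Translation automorphisms -/

/-- The permutation of the basis vectors induced by a translation, as a unitary operator. -/
def shiftOp (a : Spacetime) : WeylSpace ≃ₗᵢ[ℂ] WeylSpace :=
  weightedPerm (translatePerm a) (fun _ => 1) (fun _ => by simp)

lemma shiftOp_weylOp (a : Spacetime) (f : FieldSpace) :
    (shiftOp a).conjStarAlgEquiv (weylOp f) = weylOp (translateField a f) := by
  ext ψ i
  change shiftOp a (weylOp f ((shiftOp a).symm ψ)) i = _
  rw [weylOp_apply]
  change 1 * weylOp f ((shiftOp a).symm ψ) (translateField (-a) i) = _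
  rw [weylOp_apply]
  change 1 * (_ * (conj 1 * ψ (translateField a (translateField (-a) i - f)))) = _
  have h1 : translateField a (translateField (-a) i) = i := (translatePerm a).right_inv i
  rw [map_sub, h1, ← form_translateField a, h1]
  simp

lemma shiftOp_mem (a : Spacetime) (T : WeylSpace →L[ℂ] WeylSpace) (hT : T ∈ weylSubalgebra) :
    (shiftOp a).conjStarAlgEquiv T ∈ weylSubalgebra := by
  let α : (WeylSpace →L[ℂ] WeylSpace) →⋆ₐ[ℂ] (WeylSpace →L[ℂ] WeylSpace) :=
    ((shiftOp a).conjStarAlgEquiv : _ →⋆ₐ[ℂ] _)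
  have hcont : Continuous α := map_continuous α
  have hadj : StarAlgebra.adjoin ℂ (Set.range weylOp) ≤ weylSubalgebra.comap α := by
    refine StarAlgebra.adjoin_le ?_
    rintro _ ⟨f, rfl⟩
    change (shiftOp a).conjStarAlgEquiv (weylOp f) ∈ weylSubalgebra
    rw [shiftOp_weylOp]
    exact weylOp_mem _
  have hcl : IsClosed (weylSubalgebra.comap α : Set (WeylSpace →L[ℂ] WeylSpace)) :=
    (inferInstance : IsClosed (weylSubalgebra : Set (WeylSpace →L[ℂ] WeylSpace))).preimage hcont
  exact StarSubalgebra.topologicalClosure_minimal hadj hcl hT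

/-- The automorphism `α_a` of the Weyl algebra implementing the translation by `a`; it maps `W(f)`
to `W(f(· - a))`. -/
def translationAut (a : Spacetime) : WeylAlgebra →⋆ₐ[ℂ] WeylAlgebra :=
  StarAlgHom.codRestrict
    (((shiftOp a).conjStarAlgEquiv :
      (WeylSpace →L[ℂ] WeylSpace) →⋆ₐ[ℂ] (WeylSpace →L[ℂ] WeylSpace)).comp WeylAlgebra.incl)
    weylSubalgebra (fun x => shiftOp_mem a x.1 x.2)

theorem translationAut_weyl (a : Spacetime) (f : TestFn) :
    translationAut a (weyl f) = weyl (translate a f) :=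
  WeylAlgebra.incl_injective (shiftOp_weylOp a (toField f))

lemma continuous_translationAut (a : Spacetime) : Continuous (translationAut a) :=
  map_continuous (translationAut a)

lemma eq_of_eq_weyl {E : Type*} [AddCommGroup E] [Module ℂ E] [TopologicalSpace E] [T2Space E]
    {F G : WeylAlgebra →ₗ[ℂ] E} (hF : Continuous F) (hG : Continuous G)
    (h : ∀ f, F (weyl f) = G (weyl f)) (x : WeylAlgebra) : F x = G x := by
  have : Set.EqOn F G (Submodule.span ℂ (Set.range weyl)) := by
    refine LinearMap.eqOn_span ?_
    rintro _ ⟨f, rfl⟩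
    exact h f
  exact congrFun (Continuous.ext_on dense_span_weyl hF hG this) x

theorem translationAut_add (a b : Spacetime) (x : WeylAlgebra) :
    translationAut (a + b) x = translationAut a (translationAut b x) :=
  eq_of_eq_weyl (F := (translationAut (a + b)).toAlgHom.toLinearMap)
    (G := (translationAut a).toAlgHom.toLinearMap ∘ₗ (translationAut b).toAlgHom.toLinearMap)
    (continuous_translationAut _)
    ((continuous_translationAut a).comp (continuous_translationAut b))
    (fun f => by
      change translationAut (a + b) (weyl f) = translationAut a (translationAut b (weyl f))
      simp only [translationAut_weyl, translate_add]) x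

theorem translationAut_zero (x : WeylAlgebra) : translationAut 0 x = x :=
  eq_of_eq_weyl (F := (translationAut 0).toAlgHom.toLinearMap) (G := LinearMap.id)
    (continuous_translationAut _) continuous_id
    (fun f => by
      change translationAut 0 (weyl f) = weyl f
      simp only [translationAut_weyl, translate_zero]) x

/-- The vacuum state is invariant under translations. -/
theorem vacuumState_translationAut (a : Spacetime) (x : WeylAlgebra) :
    vacuumState (translationAut a x) = vacuumState x :=
  eq_of_eq_weyl (F := vacuumState.toLinearMap ∘ₗ (translationAut a).toAlgHom.toLinearMap)
    (G := vacuumState.toLinearMap)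
    (continuous_vacuumState.comp (continuous_translationAut a)) continuous_vacuumState
    (fun f => by
      change vacuumState (translationAut a (weyl f)) = vacuumState (weyl f)
      simp only [translationAut_weyl, vacuumState_weyl, vacuumValue_translate]) x

/-! ### The vacuum representation -/

/-- The Hilbert space of the GNS representation of the vacuum state. -/
abbrev VacuumSpace : Type := vacuumState.GNS

/-- The GNS representation of the vacuum state. -/
def vacuumRep : WeylAlgebra →⋆ₐ[ℂ] (VacuumSpace →L[ℂ] VacuumSpace) := vacuumState.gnsStarAlgHom

/-- The vacuum vector. -/
def Omega : VacuumSpace := ((vacuumState.toPreGNS 1 : vacuumState.PreGNS) : VacuumSpace)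

lemma vacuumRep_Omega (x : WeylAlgebra) :
    vacuumRep x Omega = ((vacuumState.toPreGNS x : vacuumState.PreGNS) : VacuumSpace) := by
  change vacuumState.gnsNonUnitalStarAlgHom x _ = _
  rw [Omega, PositiveLinearMap.gnsNonUnitalStarAlgHom_apply_coe]
  simp

/-- The vacuum vector implements the vacuum state. -/
theorem inner_Omega (x : WeylAlgebra) : inner ℂ Omega (vacuumRep x Omega) = vacuumState x := by
  rw [vacuumRep_Omega, Omega, UniformSpace.Completion.inner_coe]
  rw [PositiveLinearMap.preGNS_inner_def]; simp

/-- The vacuum vector is cyclic. -/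
theorem dense_Omega : DenseRange fun x : WeylAlgebra => vacuumRep x Omega := by
  simp only [vacuumRep_Omega]
  exact UniformSpace.Completion.denseRange_coe.comp vacuumState.toPreGNS.surjective.denseRange
    (UniformSpace.Completion.continuous_coe _)

/-- The isometry of the pre-Hilbert space induced by a translation. -/
def preTranslation (a : Spacetime) : vacuumState.PreGNS →ₗᵢ[ℂ] vacuumState.PreGNS where
  toLinearMap := vacuumState.toPreGNS.toLinearMap ∘ₗ
    (translationAut a).toAlgHom.toLinearMap ∘ₗ vacuumState.ofPreGNS.toLinearMap
  norm_map' x := by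
    rw [PositiveLinearMap.preGNS_norm_def, PositiveLinearMap.preGNS_norm_def]
    have : ∀ y : WeylAlgebra, vacuumState (star (translationAut a y) * translationAut a y) =
        vacuumState (star y * y) := fun y => by
      rw [← map_star, ← map_mul, vacuumState_translationAut]
    exact congrArg (fun z : ℂ => √z.re) (this (vacuumState.ofPreGNS x))

/-- The continuous extension of `preTranslation` to the vacuum Hilbert space. -/
def translationMap (a : Spacetime) : VacuumSpace →L[ℂ] VacuumSpace :=
  (preTranslation a).toContinuousLinearMap.completion

lemma translationMap_Omega (a : Spacetime) (x : WeylAlgebra) :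
    translationMap a (vacuumRep x Omega) = vacuumRep (translationAut a x) Omega := by
  rw [vacuumRep_Omega, vacuumRep_Omega, translationMap, ContinuousLinearMap.completion_apply_coe]
  rfl

lemma translationMap_add (a b : Spacetime) (Ψ : VacuumSpace) :
    translationMap (a + b) Ψ = translationMap a (translationMap b Ψ) := by
  refine congrFun (dense_Omega.equalizer (translationMap (a + b)).continuous
    ((translationMap a).continuous.comp (translationMap b).continuous) ?_) Ψ
  funext x
  simp only [Function.comp, translationMap_Omega, translationAut_add]

lemma translationMap_zero (Ψ : VacuumSpace) : translationMap 0 Ψ = Ψ := by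
  refine congrFun (dense_Omega.equalizer (translationMap 0).continuous continuous_id ?_) Ψ
  funext x
  simp only [Function.comp, translationMap_Omega, translationAut_zero, id]

/-- The unitary operator `U(a)` implementing the translation by `a` in the vacuum representation:
`U(a) π(x) Ω = π(α_a(x)) Ω`. -/
def U (a : Spacetime) : VacuumSpace ≃ₗᵢ[ℂ] VacuumSpace where
  toFun := translationMap a
  map_add' := map_add _
  map_smul' := map_smul _
  invFun := translationMap (-a)
  left_inv Ψ := by rw [← translationMap_add, neg_add_cancel, translationMap_zero]
  right_inv Ψ := by rw [← translationMap_add, add_neg_cancel, translationMap_zero]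
  norm_map' Ψ := by
    refine congrFun (dense_Omega.equalizer ((translationMap a).continuous.norm) continuous_norm ?_) Ψ
    funext x
    simp only [Function.comp, vacuumRep_Omega, translationMap,
      ContinuousLinearMap.completion_apply_coe, UniformSpace.Completion.norm_coe]
    exact (preTranslation a).norm_map _

theorem U_vacuumRep_Omega (a : Spacetime) (x : WeylAlgebra) :
    U a (vacuumRep x Omega) = vacuumRep (translationAut a x) Omega :=
  translationMap_Omega a x

theorem U_Omega (a : Spacetime) : U a Omega = Omega := by
  have := U_vacuumRep_Omega a 1
  simpa using this

theorem U_add (a b : Spacetime) (Ψ : VacuumSpace) : U (a + b) Ψ = U a (U b Ψ) :=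
  translationMap_add a b Ψ

/-- The translations implement the automorphisms `α_a`. -/
theorem U_conj (a : Spacetime) (x : WeylAlgebra) (Ψ : VacuumSpace) :
    U a (vacuumRep x Ψ) = vacuumRep (translationAut a x) (U a Ψ) := by
  refine congrFun (dense_Omega.equalizer ((U a).continuous.comp (vacuumRep x).continuous)
    ((vacuumRep (translationAut a x)).continuous.comp (U a).continuous) ?_) Ψ
  funext y
  have h1 : vacuumRep x (vacuumRep y Omega) = vacuumRep (x * y) Omega := by rw [map_mul]; rfl
  have h2 : vacuumRep (translationAut a x) (vacuumRep (translationAut a y) Omega) =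
      vacuumRep (translationAut a x * translationAut a y) Omega := by rw [map_mul]; rfl
  simp only [Function.comp, h1, U_vacuumRep_Omega, h2]
  rw [map_mul]

/-- The subspace of vectors invariant under the lightlike translations `U(t, λ t)`, where
`λ = 1` or `λ = -1`. -/
def waveSpace (lam : ℤˣ) : Submodule ℂ VacuumSpace where
  carrier := {Ψ | ∀ t : ℝ, U (t, ((lam : ℤ) : ℝ) * t) Ψ = Ψ}
  add_mem' hΨ hΦ t := by rw [map_add, hΨ t, hΦ t]
  zero_mem' t := map_zero _
  smul_mem' c Ψ hΨ t := by rw [map_smul, hΨ t]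

/-- The `C*`-subalgebra `𝓐` generated by the Weyl operators of test functions without charge. -/
def neutralAlgebra : StarSubalgebra ℂ WeylAlgebra :=
  (StarAlgebra.adjoin ℂ {x | ∃ f : TestFn, charge f = 0 ∧ x = weyl f}).topologicalClosure

/-- The neutral subspace, the closure of `π(𝓐) Ω`. -/
def neutralSpace : Submodule ℂ VacuumSpace :=
  (Submodule.span ℂ {Ψ | ∃ x ∈ neutralAlgebra, Ψ = vacuumRep x Omega}).topologicalClosure

end MasslessField

end

/-!
The proof rests on the modulus of the matrix element `⟨Ω, W(g) W(f_t) Ω⟩`, where `f_t` is `f`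
translated by `(t, λ t)`. By the Weyl relations it is the modulus of the vacuum expectation value of
`W(h)` with `h = g + f_t`. It vanishes if `h` is charged. Otherwise it is `exp (- w₀(h, h) / 2)`, with
`2π w₀(h, h) = ∫ |ĝ(p) + exp(i (|p| - λ p) t) f̂(p)|² / (2 |p|) dp`.

For `q = q_f = - q_g` this integral equals `q² log |t| + O(1)`. Indeed, up to an error bounded by a
`t`-independent integrable function, the integrand is `q² (1 - cos ((|p| - λ p) t)) / |p|` on
`[-1, 1]` and zero elsewhere (`exists_lightlike_integrand_bound`). The phase vanishes for one sign of
`p`, and the other half line yields `∫₀¹ (1 - cos (2 t p)) / p dp = log |t| + O(1)`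
(`exists_integral_one_sub_cos_log`). Exponentiating gives the power `|t| ^ (- q² / (4π))`
(`isTheta_inner_lightlike`).

Consequently, for charged `f`, the vectors `W(f_t) Ω` converge weakly to zero as `t → ∞`
(`tendsto_inner_lightlike`). A vector `Ψ` invariant under `U(t, λ t)` satisfies
`⟨W(f) Ω, Ψ⟩ = ⟨W(f_t) Ω, Ψ⟩` for all `t`, so it is orthogonal to all charged Weyl vectors. As the
Weyl vectors are total and those of different charge are orthogonal, `Ψ` lies in the closed span of
the neutral ones.
-/

namespace MasslessField

/-! ### A logarithmically divergent cosine integral -/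

lemma norm_one_sub_cos_div_le (u : ℝ) : ‖(1 - Real.cos u) / u‖ ≤ 1 := by
  rw [norm_div]
  refine div_le_one_of_le₀ ?_ (norm_nonneg _)
  have h := Real.abs_cos_sub_cos_le 0 u
  simpa using h

lemma measurable_one_sub_cos_div : Measurable fun u : ℝ => (1 - Real.cos u) / u := by
  fun_prop

lemma intervalIntegrable_one_sub_cos_div (a b : ℝ) :
    IntervalIntegrable (fun u : ℝ => (1 - Real.cos u) / u) volume a b := by
  refine (intervalIntegrable_const (c := (1 : ℝ))).mono_fun
    measurable_one_sub_cos_div.aestronglyMeasurable (ae_of_all _ fun u => ?_)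
  simpa using norm_one_sub_cos_div_le u

/-- Integration by parts bounds the integral uniformly in the upper endpoint. -/
lemma abs_integral_cos_div_le {T : ℝ} (hT : 1 ≤ T) : |∫ u in (1 : ℝ)..T, Real.cos u / u| ≤ 3 := by
  have hpos : ∀ u ∈ Set.uIcc 1 T, 0 < u := fun u hu => by
    rw [Set.uIcc_of_le hT] at hu; linarith [hu.1]
  have hne : ∀ u ∈ Set.uIcc 1 T, u ≠ 0 := fun u hu => (hpos u hu).ne'
  have hd : ∀ u ∈ Set.uIcc 1 T, HasDerivAt (fun u : ℝ => Real.sin u / u)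
      (Real.cos u / u - Real.sin u / u ^ 2) u := fun u hu => by
    have := (Real.hasDerivAt_sin u).div (hasDerivAt_id u) (hne u hu)
    refine this.congr_deriv ?_
    have := hne u hu
    simp only [id]
    field_simp
  have hc : IntervalIntegrable (fun u : ℝ => Real.cos u / u) volume 1 T :=
    (ContinuousOn.div (by fun_prop) (by fun_prop) hne).intervalIntegrable
  have hs : IntervalIntegrable (fun u : ℝ => Real.sin u / u ^ 2) volume 1 T :=
    (ContinuousOn.div (by fun_prop) (by fun_prop) fun u hu =>
      pow_ne_zero 2 (hne u hu)).intervalIntegrable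
  have hp : IntervalIntegrable (fun u : ℝ => (u ^ 2)⁻¹) volume 1 T :=
    (ContinuousOn.inv₀ (by fun_prop) fun u hu => pow_ne_zero 2 (hne u hu)).intervalIntegrable
  have h1 := intervalIntegral.integral_eq_sub_of_hasDerivAt hd (hc.sub hs)
  rw [intervalIntegral.integral_sub hc hs] at h1
  have h2 : |∫ u in (1 : ℝ)..T, Real.sin u / u ^ 2| ≤ ∫ u in (1 : ℝ)..T, (u ^ 2)⁻¹ := by
    rw [← Real.norm_eq_abs]
    refine intervalIntegral.norm_integral_le_of_norm_le hT
      (ae_of_all _ fun u hu => ?_) hp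
    have hu0 : 0 < u := by linarith [hu.1]
    rw [norm_div, div_eq_mul_inv, Real.norm_eq_abs, Real.norm_eq_abs, abs_of_pos (by positivity :
      (0 : ℝ) < u ^ 2)]
    exact mul_le_of_le_one_left (by positivity) (Real.abs_sin_le_one u)
  have h3 : ∫ u in (1 : ℝ)..T, (u ^ 2)⁻¹ = 1 - T⁻¹ := by
    have hd' : ∀ u ∈ Set.uIcc 1 T, HasDerivAt (fun u : ℝ => -u⁻¹) ((u ^ 2)⁻¹) u := fun u hu => by
      have h := (hasDerivAt_inv (hne u hu)).neg
      rw [neg_neg] at h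
      exact h
    rw [intervalIntegral.integral_eq_sub_of_hasDerivAt hd' hp]
    simp; ring
  have hT0 : 0 < T⁻¹ := by positivity
  have h4 : |Real.sin T / T| ≤ 1 := by
    rw [abs_div, abs_of_pos (by linarith : 0 < T)]
    exact div_le_one_of_le₀ ((Real.abs_sin_le_one T).trans hT) (by linarith)
  have h5 := Real.abs_sin_le_one 1
  rw [div_one] at h1
  rw [abs_le] at *
  constructor <;> linarith [h2.1, h2.2, h4.1, h4.2, h5.1, h5.2]

/-- The infrared cut-off at `p ≈ 1 / |t|` produced by the cosine turns the logarithmically divergent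
integral of `1 / p` into `log |t|`, up to a bounded error. -/
lemma exists_integral_one_sub_cos_log : ∃ C : ℝ, ∀ t : ℝ, 1 ≤ |t| →
    |(∫ p in (0 : ℝ)..1, (1 - Real.cos (2 * t * p)) / p) - Real.log (|t|)| ≤ C := by
  -- After substituting `u = 2 |t| p`, only `∫ u in 1..2|t|, 1 / u` is unbounded in `t`.
  refine ⟨|∫ u in (0 : ℝ)..1, (1 - Real.cos u) / u| + |Real.log 2| + 3, fun t ht => ?_⟩
  have hT : 1 ≤ 2 * |t| := by linarith
  have e1 : ∫ p in (0 : ℝ)..1, (1 - Real.cos (2 * t * p)) / p =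
      ∫ u in (0 : ℝ)..(2 * |t|), (1 - Real.cos u) / u := by
    have h := intervalIntegral.mul_integral_comp_mul_left (a := 0) (b := 1)
      (f := fun u : ℝ => (1 - Real.cos u) / u) (2 * |t|)
    rw [mul_zero, mul_one] at h
    rw [← h, ← intervalIntegral.integral_const_mul]
    congr 1 with p
    have hcos : Real.cos (2 * |t| * p) = Real.cos (2 * t * p) := by
      rcases abs_choice t with h | h <;> rw [h]
      rw [← Real.cos_neg]; congr 1; ring
    rw [hcos]
    field_simp
  have hne : ∀ u ∈ Set.uIcc 1 (2 * |t|), u ≠ 0 := fun u hu => by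
    rw [Set.uIcc_of_le hT] at hu; linarith [hu.1]
  have hc : IntervalIntegrable (fun u : ℝ => Real.cos u / u) volume 1 (2 * |t|) :=
    (ContinuousOn.div (by fun_prop) (by fun_prop) hne).intervalIntegrable
  have hi : IntervalIntegrable (fun u : ℝ => u⁻¹) volume 1 (2 * |t|) :=
    (ContinuousOn.inv₀ (by fun_prop) hne).intervalIntegrable
  have e2 : ∫ u in (1 : ℝ)..(2 * |t|), (1 - Real.cos u) / u =
      Real.log 2 + Real.log (|t|) - ∫ u in (1 : ℝ)..(2 * |t|), Real.cos u / u := by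
    rw [← Real.log_mul (by norm_num) (by linarith), ← div_one (2 * |t|),
      ← integral_inv_of_pos one_pos (by linarith), div_one, ← intervalIntegral.integral_sub hi hc]
    congr 1 with u
    rw [sub_div, one_div]
  rw [e1, ← intervalIntegral.integral_add_adjacent_intervals
    (intervalIntegrable_one_sub_cos_div 0 1) (intervalIntegrable_one_sub_cos_div 1 _), e2]
  have h3 := abs_integral_cos_div_le hT
  have h1 := abs_le.1 (le_refl |∫ u in (0 : ℝ)..1, (1 - Real.cos u) / u|)
  have h2 := abs_le.1 (le_refl |Real.log 2|)
  rw [abs_le] at h3 ⊢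
  constructor <;> linarith [h1.1, h1.2, h2.1, h2.2, h3.1, h3.2]

/-- The phase `|p| - λ p` of a lightlike translation vanishes for one sign of the momentum and equals
`2 |p|` for the other, so that only one half line contributes to the divergence. -/
lemma integral_lightlike_phase (lam : ℤˣ) (t : ℝ) :
    IntervalIntegrable (fun p : ℝ => (1 - Real.cos ((|p| - ((lam : ℤ) : ℝ) * p) * t)) / |p|)
      volume (-1) 1 ∧
    ∫ p in (-1 : ℝ)..1, (1 - Real.cos ((|p| - ((lam : ℤ) : ℝ) * p) * t)) / |p| =
      ∫ p in (0 : ℝ)..1, (1 - Real.cos (2 * t * p)) / p := by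
  have hint : ∀ a b : ℝ, IntervalIntegrable
      (fun p : ℝ => (1 - Real.cos ((|p| - ((lam : ℤ) : ℝ) * p) * t)) / |p|) volume a b := by
    intro a b
    refine (intervalIntegrable_const (c := 2 * |t|)).mono_fun
      (Measurable.aestronglyMeasurable (by fun_prop)) (ae_of_all _ fun p => ?_)
    beta_reduce
    rw [norm_div, Real.norm_eq_abs, Real.norm_eq_abs, Real.norm_eq_abs, abs_abs]
    refine div_le_of_le_mul₀ (abs_nonneg _) (abs_nonneg _) ?_
    have h := Real.abs_cos_sub_cos_le 0 ((|p| - ((lam : ℤ) : ℝ) * p) * t)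
    rw [Real.cos_zero, zero_sub, abs_neg, abs_mul] at h
    have hl : |((lam : ℤ) : ℝ)| = 1 := by rcases Int.units_eq_one_or lam with rfl | rfl <;> simp
    have h2 : |(|p| - ((lam : ℤ) : ℝ) * p)| ≤ 2 * |p| := by
      refine (abs_sub _ _).trans ?_
      rw [abs_abs, abs_mul, hl]; linarith
    rw [abs_of_nonneg (by positivity : (0 : ℝ) ≤ 2 * |t|)]
    calc _ ≤ _ := h
      _ ≤ 2 * |p| * |t| := by gcongr
      _ = _ := by ring
  refine ⟨hint _ _, ?_⟩
  rw [← intervalIntegral.integral_add_adjacent_intervals (hint (-1) 0) (hint 0 1)]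
  have hflip := intervalIntegral.integral_comp_neg (a := 0) (b := 1)
    (fun p : ℝ => (1 - Real.cos ((|p| - ((lam : ℤ) : ℝ) * p) * t)) / |p|)
  rw [neg_zero] at hflip
  rw [← hflip]
  have hpos : ∀ p ∈ Set.uIcc (0 : ℝ) 1, |p| = p := fun p hp => by
    rw [Set.uIcc_of_le zero_le_one] at hp; exact abs_of_nonneg hp.1
  rcases Int.units_eq_one_or lam with rfl | rfl
  · have h1 : ∫ p in (0 : ℝ)..1, (1 - Real.cos ((|(-p)| - (((1 : ℤˣ) : ℤ) : ℝ) * -p) * t)) / |(-p)| =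
        ∫ p in (0 : ℝ)..1, (1 - Real.cos (2 * t * p)) / p := by
      refine intervalIntegral.integral_congr fun p hp => ?_
      simp only [abs_neg, hpos p hp]
      congr 3; push_cast; ring
    have h2 : ∫ p in (0 : ℝ)..1, (1 - Real.cos ((|p| - (((1 : ℤˣ) : ℤ) : ℝ) * p) * t)) / |p| =
        ∫ p in (0 : ℝ)..1, (0 : ℝ) :=
      intervalIntegral.integral_congr fun p hp => by simp [hpos p hp]
    rw [h1, h2]; simp
  · have h1 : ∫ p in (0 : ℝ)..1,
        (1 - Real.cos ((|(-p)| - (((-1 : ℤˣ) : ℤ) : ℝ) * -p) * t)) / |(-p)| =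
        ∫ p in (0 : ℝ)..1, (0 : ℝ) :=
      intervalIntegral.integral_congr fun p hp => by simp [hpos p hp]
    have h2 : ∫ p in (0 : ℝ)..1, (1 - Real.cos ((|p| - (((-1 : ℤˣ) : ℤ) : ℝ) * p) * t)) / |p| =
        ∫ p in (0 : ℝ)..1, (1 - Real.cos (2 * t * p)) / p := by
      refine intervalIntegral.integral_congr fun p hp => ?_
      simp only [hpos p hp]
      congr 3; push_cast; ring
    rw [h1, h2]; simp

/-! ### The two-point function along lightlike translations -/

lemma charge_translate (a : Spacetime) (f : TestFn) : charge (translate a f) = charge f :=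
  integral_sub_right_eq_self (fun x => f x) a

lemma twoPoint_self_re (m : ℝ) (f : TestFn) : 2 * Real.pi * (twoPoint m f f).re =
    ∫ p : ℝ, ‖shellFourier m p f‖ ^ 2 / (2 * energy m p) := by
  have : twoPoint m f f = (((2 * Real.pi)⁻¹ *
      ∫ p : ℝ, ‖shellFourier m p f‖ ^ 2 / (2 * energy m p) : ℝ) : ℂ) := by
    unfold twoPoint
    push_cast
    rw [← integral_complex_ofReal]
    congr 2; ext p; rw [Complex.conj_mul']; push_cast; rfl
  rw [this, Complex.ofReal_re, ← mul_assoc, mul_inv_cancel₀ (by positivity), one_mul]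

lemma measurable_shell_norm_sq (m : ℝ) (f : TestFn) :
    Measurable fun p : ℝ => ‖shellFourier m p f‖ ^ 2 / (2 * energy m p) := by
  have c0 : Continuous fun p : ℝ => (m, p) := by fun_prop
  have c1 := (continuous_shell f).comp c0
  have c2 := continuous_energy.comp c0
  exact (c1.norm.pow 2).measurable.div (c2.measurable.const_mul 2)

lemma shell_lightlike (lam : ℤˣ) (t p : ℝ) (f : TestFn) :
    shellFourier 0 p (translate (t, ((lam : ℤ) : ℝ) * t) f) =
      Complex.exp ((((|p| - ((lam : ℤ) : ℝ) * p) * t : ℝ) : ℂ) * Complex.I) *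
        shellFourier 0 p f := by
  rw [shell_translate, energy_zero]
  congr 4; ring

lemma norm_add_phase_mul_sq (z w : ℂ) (θ : ℝ) :
    ‖z + Complex.exp (θ * Complex.I) * w‖ ^ 2 = (conj z * z).re + (conj w * w).re +
      2 * (Complex.exp (θ * Complex.I) * (conj z * w)).re := by
  rw [Complex.sq_norm, Complex.normSq_add, Complex.normSq_mul, Complex.normSq_eq_norm_sq
    (Complex.exp _), Complex.norm_exp_ofReal_mul_I]
  simp [Complex.normSq_apply]
  ring

/-- Replacing the test functions by their charges changes the integrand by a majorant which is
independent of the time `t`: at small momenta the error vanishes linearly and cancels the `1 / |p|`. -/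
lemma exists_lightlike_integrand_bound (lam : ℤˣ) {f g : TestFn} (hq : charge f + charge g = 0) :
    ∃ K : ℝ, 0 ≤ K ∧ ∀ t p : ℝ,
      ‖‖shellFourier 0 p (g + translate (t, ((lam : ℤ) : ℝ) * t) f)‖ ^ 2 / (2 * energy 0 p) -
        (Set.Ioc (-1 : ℝ) 1).indicator (fun p => charge f ^ 2 *
          ((1 - Real.cos ((|p| - ((lam : ℤ) : ℝ) * p) * t)) / |p|)) p‖ ≤ K * (1 + p ^ 2)⁻¹ := by
  obtain ⟨K₁, hK₁, h₁⟩ := exists_pair_bound g g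
  obtain ⟨K₂, hK₂, h₂⟩ := exists_pair_bound f f
  obtain ⟨K₃, hK₃, h₃⟩ := exists_pair_bound g f
  have hg : charge g = -charge f := by linarith
  refine ⟨K₁ + K₂ + 2 * K₃, by positivity, fun t p => ?_⟩
  obtain ⟨a₁, b₁⟩ := h₁ 0 p
  obtain ⟨a₂, b₂⟩ := h₂ 0 p
  obtain ⟨a₃, b₃⟩ := h₃ 0 p
  rw [shell_add, shell_lightlike, norm_add_phase_mul_sq]
  rw [energy_zero, hg] at *
  set θ : ℝ := (|p| - ((lam : ℤ) : ℝ) * p) * t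
  set A := conj (shellFourier 0 p g) * shellFourier 0 p g
  set B := conj (shellFourier 0 p f) * shellFourier 0 p f
  set D := conj (shellFourier 0 p g) * shellFourier 0 p f
  have hexp : ∀ z : ℂ, |(Complex.exp (θ * Complex.I) * z).re| ≤ ‖z‖ := fun z => by
    refine (Complex.abs_re_le_norm _).trans (le_of_eq ?_)
    rw [norm_mul, Complex.norm_exp_ofReal_mul_I, one_mul]
  -- Used for `|p| ≥ 1`, where `1 / (2 |p|) ≤ 1`.
  have hfar : |A.re + B.re + 2 * (Complex.exp (θ * Complex.I) * D).re| ≤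
      (K₁ + K₂ + 2 * K₃) * (1 + p ^ 2)⁻¹ := by
    have c₁ := abs_le.1 ((Complex.abs_re_le_norm A).trans a₁)
    have c₂ := abs_le.1 ((Complex.abs_re_le_norm B).trans a₂)
    have c₃ := abs_le.1 ((hexp D).trans a₃)
    rw [abs_le]
    constructor <;> linarith [c₁.1, c₁.2, c₂.1, c₂.2, c₃.1, c₃.2]
  -- Used for `|p| ≤ 1`: the numerator differs by `O(|p|)` from its value with `q_f`, `q_g = -q_f`.
  have hnear : |A.re + B.re + 2 * (Complex.exp (θ * Complex.I) * D).re -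
      2 * charge f ^ 2 * (1 - Real.cos θ)| ≤ (K₁ + K₂ + 2 * K₃) * |p| := by
    have c₁ := abs_le.1 ((Complex.abs_re_le_norm _).trans b₁)
    have c₂ := abs_le.1 ((Complex.abs_re_le_norm _).trans b₂)
    have c₃ := abs_le.1 ((hexp _).trans b₃)
    have e₃ : (Complex.exp (θ * Complex.I) * (D - ((-charge f : ℝ) : ℂ) * (charge f : ℂ))).re =
        (Complex.exp (θ * Complex.I) * D).re + charge f ^ 2 * Real.cos θ := by
      rw [mul_sub, Complex.sub_re, ← Complex.ofReal_mul, Complex.re_mul_ofReal,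
        Complex.exp_ofReal_mul_I_re]
      ring
    rw [e₃] at c₃
    rw [Complex.sub_re, ← Complex.ofReal_mul, Complex.ofReal_re] at c₁ c₂
    rw [abs_le]
    constructor <;> linarith [c₁.1, c₁.2, c₂.1, c₂.2, c₃.1, c₃.2]
  by_cases hp : p ∈ Set.Ioc (-1 : ℝ) 1
  · rw [Set.indicator_of_mem hp]
    rcases eq_or_ne p 0 with rfl | hp0
    · simp; positivity
    have hp1 : |p| ≤ 1 := abs_le.2 ⟨hp.1.le, hp.2⟩
    have hpp : 0 < |p| := abs_pos.2 hp0
    have e : ∀ x : ℝ, x / (2 * |p|) - charge f ^ 2 * ((1 - Real.cos θ) / |p|) =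
        (x - 2 * charge f ^ 2 * (1 - Real.cos θ)) / (2 * |p|) := fun x => by field_simp
    rw [e, norm_div, Real.norm_eq_abs, Real.norm_eq_abs, abs_of_pos (by positivity : 0 < 2 * |p|),
      div_le_iff₀ (by positivity)]
    refine hnear.trans ?_
    rw [mul_assoc]
    refine mul_le_mul_of_nonneg_left ?_ (by positivity)
    rw [← div_eq_inv_mul, le_div_iff₀ (by positivity), ← sq_abs p]
    nlinarith
  · rw [Set.indicator_of_notMem hp, sub_zero, norm_div, Real.norm_eq_abs, Real.norm_eq_abs]
    have hp1 : 1 ≤ |p| := by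
      by_contra! h
      exact hp ⟨(abs_lt.1 h).1, (abs_lt.1 h).2.le⟩
    refine (div_le_self (abs_nonneg _) ?_).trans hfar
    rw [abs_of_pos (by linarith)]; linarith

/-- The massless two-point function of the neutral superposition `g + f(· - (t, λ t))` grows like
`q² log |t| / (2 π)`, up to a bounded error. -/
lemma exists_twoPoint_lightlike_bound (lam : ℤˣ) {f g : TestFn} (hq : charge f + charge g = 0) :
    ∃ C : ℝ, ∀ t : ℝ, 1 ≤ |t| →
      |2 * Real.pi * (twoPoint 0 (g + translate (t, ((lam : ℤ) : ℝ) * t) f)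
        (g + translate (t, ((lam : ℤ) : ℝ) * t) f)).re - charge f ^ 2 * Real.log (|t|)| ≤ C := by
  obtain ⟨K, hK, hb⟩ := exists_lightlike_integrand_bound lam hq
  obtain ⟨C, hC⟩ := exists_integral_one_sub_cos_log
  refine ⟨(∫ p : ℝ, K * (1 + p ^ 2)⁻¹) + charge f ^ 2 * C, fun t ht => ?_⟩
  set h := g + translate (t, ((lam : ℤ) : ℝ) * t) f
  obtain ⟨hI, hE⟩ := integral_lightlike_phase lam t
  rw [twoPoint_self_re]
  set Φ : ℝ → ℝ := fun p => charge f ^ 2 * ((1 - Real.cos ((|p| - ((lam : ℤ) : ℝ) * p) * t)) / |p|)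
  have hΦ : Integrable ((Set.Ioc (-1 : ℝ) 1).indicator Φ) := by
    rw [integrable_indicator_iff measurableSet_Ioc]
    exact (intervalIntegrable_iff_integrableOn_Ioc_of_le (by norm_num)).1 (hI.const_mul _)
  have hΦi : ∫ p, (Set.Ioc (-1 : ℝ) 1).indicator Φ p =
      charge f ^ 2 * ∫ p in (0 : ℝ)..1, (1 - Real.cos (2 * t * p)) / p := by
    rw [integral_indicator measurableSet_Ioc, ← intervalIntegral.integral_of_le (by norm_num),
      intervalIntegral.integral_const_mul, hE]
  have hd : Integrable fun p : ℝ => ‖shellFourier 0 p h‖ ^ 2 / (2 * energy 0 p) -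
      (Set.Ioc (-1 : ℝ) 1).indicator Φ p :=
    (inv_sq_integrable K).mono'
      ((measurable_shell_norm_sq 0 h).aestronglyMeasurable.sub hΦ.aestronglyMeasurable)
      (ae_of_all _ (hb t))
  have hF : Integrable fun p : ℝ => ‖shellFourier 0 p h‖ ^ 2 / (2 * energy 0 p) := by
    exact (hd.add hΦ).congr (ae_of_all _ fun p => sub_add_cancel _ _)
  have h1 := norm_integral_le_of_norm_le (inv_sq_integrable K) (ae_of_all _ (hb t))
  rw [integral_sub hF hΦ, hΦi, Real.norm_eq_abs] at h1
  have h2 := mul_le_mul_of_nonneg_left (hC t ht) (sq_nonneg (charge f))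
  rw [← abs_of_nonneg (sq_nonneg (charge f)), ← abs_mul, abs_of_nonneg (sq_nonneg (charge f)),
    mul_sub] at h2
  rw [abs_le] at h1 h2 ⊢
  constructor <;> linarith [h1.1, h1.2, h2.1, h2.2]

/-! ### Matrix elements between Weyl vectors -/

lemma inner_Omega_weyl_weyl (f g : TestFn) :
    inner ℂ Omega (vacuumRep (weyl g) (vacuumRep (weyl f) Omega)) =
      Complex.exp (-(commutator g f) / 2) * vacuumValue (g + f) := by
  have h : vacuumRep (weyl g) (vacuumRep (weyl f) Omega) = vacuumRep (weyl g * weyl f) Omega := by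
    rw [map_mul]; rfl
  rw [h, inner_Omega, weyl_mul, map_smul, vacuumState_weyl, smul_eq_mul]

/-- The commutator is imaginary, so it does not affect the modulus of the matrix elements. -/
lemma norm_inner_Omega_weyl_weyl (f g : TestFn) :
    ‖(inner ℂ Omega (vacuumRep (weyl g) (vacuumRep (weyl f) Omega)) : ℂ)‖ =
      ‖vacuumValue (g + f)‖ := by
  rw [inner_Omega_weyl_weyl, norm_mul, ← form_toField, norm_exp_form, one_mul]

lemma norm_vacuumValue_of_neutral {f : TestFn} (hf : charge f = 0) :
    ‖vacuumValue f‖ = Real.exp (-(twoPoint 0 f f).re / 2) := by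
  rw [(tendsto_vacuumValue f).2, if_pos hf, Complex.norm_exp]
  congr 1
  rw [neg_div, neg_div, Complex.neg_re]; simp

lemma inner_lightlike_eq_zero (lam : ℤˣ) {f g : TestFn} (hq : charge f + charge g ≠ 0) (t : ℝ) :
    inner ℂ Omega (vacuumRep (weyl g) (vacuumRep
      (weyl (translate (t, ((lam : ℤ) : ℝ) * t) f)) Omega)) = 0 := by
  rw [inner_Omega_weyl_weyl, (tendsto_vacuumValue _).2, if_neg, mul_zero]
  rwa [charge_add, charge_translate, add_comm]

/-- Exponentiating the logarithmic growth of the two-point function gives the power law, and its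
bounded error gives the constants. -/
lemma isTheta_inner_lightlike (lam : ℤˣ) {f g : TestFn} (hq : charge f + charge g = 0) :
    Asymptotics.IsTheta (atBot ⊔ atTop)
      (fun t : ℝ => inner ℂ Omega (vacuumRep (weyl g) (vacuumRep
        (weyl (translate (t, ((lam : ℤ) : ℝ) * t) f)) Omega)))
      (fun t : ℝ => |t| ^ (charge f * charge g / (4 * Real.pi))) := by
  obtain ⟨C, hC⟩ := exists_twoPoint_lightlike_bound lam hq
  have hg : charge g = -charge f := by linarith
  have hpi := Real.pi_pos
  have hbound : ∀ t : ℝ, 1 ≤ |t| →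
      ‖(inner ℂ Omega (vacuumRep (weyl g) (vacuumRep
        (weyl (translate (t, ((lam : ℤ) : ℝ) * t) f)) Omega)) : ℂ)‖ ≤
        Real.exp (C / (4 * Real.pi)) * ‖|t| ^ (charge f * charge g / (4 * Real.pi))‖ ∧
      ‖|t| ^ (charge f * charge g / (4 * Real.pi))‖ ≤ Real.exp (C / (4 * Real.pi)) *
        ‖(inner ℂ Omega (vacuumRep (weyl g) (vacuumRep
          (weyl (translate (t, ((lam : ℤ) : ℝ) * t) f)) Omega)) : ℂ)‖ := by
    intro t ht
    have h := abs_le.1 (hC t ht)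
    have hn : charge (g + translate (t, ((lam : ℤ) : ℝ) * t) f) = 0 := by
      rw [charge_add, charge_translate]; linarith
    rw [norm_inner_Omega_weyl_weyl, norm_vacuumValue_of_neutral hn, Real.norm_eq_abs,
      abs_of_nonneg (by positivity), Real.rpow_def_of_pos (by linarith), ← Real.exp_add,
      ← Real.exp_add, Real.exp_le_exp, Real.exp_le_exp, hg]
    set w := (twoPoint 0 (g + translate (t, ((lam : ℤ) : ℝ) * t) f)
      (g + translate (t, ((lam : ℤ) : ℝ) * t) f)).re
    have e1 : -w / 2 = -(2 * Real.pi * w) / (4 * Real.pi) := by field_simp; norm_num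
    have e2 : Real.log (|t|) * (charge f * -charge f / (4 * Real.pi)) =
      -(charge f ^ 2 * Real.log (|t|)) / (4 * Real.pi) := by ring
    rw [e1, e2, ← add_div, ← add_div]
    constructor <;> refine div_le_div_of_nonneg_right ?_ (by positivity) <;> linarith [h.1, h.2]
  have hev : ∀ᶠ t : ℝ in atBot ⊔ atTop, 1 ≤ |t| := by
    rw [eventually_sup]
    exact ⟨tendsto_abs_atBot_atTop.eventually_ge_atTop 1,
      tendsto_abs_atTop_atTop.eventually_ge_atTop 1⟩
  exact ⟨.of_bound _ (hev.mono fun t ht => (hbound t ht).1),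
    .of_bound _ (hev.mono fun t ht => (hbound t ht).2)⟩

/-! ### Charged vectors under lightlike translations -/

lemma inner_weyl_weyl (f g : TestFn) :
    inner ℂ (vacuumRep (weyl g) Omega) (vacuumRep (weyl f) Omega) =
      inner ℂ Omega (vacuumRep (weyl (-g)) (vacuumRep (weyl f) Omega)) := by
  rw [← star_weyl, map_star, ContinuousLinearMap.star_eq_adjoint,
    ContinuousLinearMap.adjoint_inner_right]

lemma inner_weyl_weyl_of_charge_ne {f g : TestFn} (h : charge f ≠ charge g) :
    inner ℂ (vacuumRep (weyl g) Omega) (vacuumRep (weyl f) Omega) = 0 := by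
  rw [inner_weyl_weyl, inner_Omega_weyl_weyl, (tendsto_vacuumValue _).2, if_neg, mul_zero]
  rw [neg_add_eq_sub, charge_sub]
  exact sub_ne_zero.2 h

lemma dense_span_weyl_Omega :
    Dense (Submodule.span ℂ (Set.range fun f => vacuumRep (weyl f) Omega) : Set VacuumSpace) := by
  let F : WeylAlgebra →ₗ[ℂ] VacuumSpace :=
    { toFun := fun x => vacuumRep x Omega
      map_add' := fun x y => by simp
      map_smul' := fun c x => by simp }
  have hF : Continuous F :=
    (ContinuousLinearMap.apply ℂ VacuumSpace Omega).continuous.comp (map_continuous vacuumRep)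
  have h := dense_Omega.dense_image hF dense_span_weyl
  have e : Submodule.span ℂ (Set.range fun f => vacuumRep (weyl f) Omega) =
      (Submodule.span ℂ (Set.range weyl)).map F := by
    rw [Submodule.map_span, ← Set.range_comp]; rfl
  rw [e]
  exact h

/-- Under large lightlike translations charged Weyl vectors tend weakly to zero. -/
lemma tendsto_inner_lightlike (lam : ℤˣ) {f : TestFn} (hf : charge f ≠ 0) (Ψ : VacuumSpace) :
    Tendsto (fun t : ℝ => inner ℂ Ψ
      (vacuumRep (weyl (translate (t, ((lam : ℤ) : ℝ) * t) f)) Omega)) atTop (𝓝 0) := by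
  set v : ℝ → VacuumSpace := fun t =>
    vacuumRep (weyl (translate (t, ((lam : ℤ) : ℝ) * t) f)) Omega with hv
  have hnorm : ∀ t, ‖v t‖ = ‖vacuumRep (weyl f) Omega‖ := fun t => by
    rw [hv]
    beta_reduce
    rw [← translationAut_weyl, ← U_vacuumRep_Omega, LinearIsometryEquiv.norm_map]
  have hweyl : ∀ g, Tendsto (fun t => inner ℂ (vacuumRep (weyl g) Omega) (v t)) atTop (𝓝 0) := by
    intro g
    simp only [hv, inner_weyl_weyl]
    by_cases hq : charge f + charge (-g) = 0
    · refine ((isTheta_inner_lightlike lam hq).1.mono le_sup_right).trans_tendsto ?_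
      have e : charge f * charge (-g) / (4 * Real.pi) = -(charge f ^ 2 / (4 * Real.pi)) := by
        rw [show charge (-g) = -charge f by linarith]; ring
      have hpi := Real.pi_pos
      rw [e]
      exact (tendsto_rpow_neg_atTop (by positivity)).comp tendsto_abs_atTop_atTop
    · simp only [inner_lightlike_eq_zero lam hq, tendsto_const_nhds]
  have hspan : ∀ Φ ∈ Submodule.span ℂ (Set.range fun g => vacuumRep (weyl g) Omega),
      Tendsto (fun t => inner ℂ Φ (v t)) atTop (𝓝 0) := by
    intro Φ hΦ
    induction hΦ using Submodule.span_induction with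
    | mem Φ h => obtain ⟨g, rfl⟩ := h; exact hweyl g
    | zero => simp
    | add Φ Φ' _ _ h h' => simpa only [inner_add_left, add_zero] using h.add h'
    | smul c Φ _ h => simpa only [inner_smul_left, mul_zero] using h.const_mul (conj c)
  rw [Metric.tendsto_nhds]
  intro ε hε
  set M := ‖vacuumRep (weyl f) Omega‖
  have hM : 0 ≤ M := norm_nonneg _
  obtain ⟨Φ, hΦ, hd⟩ := Metric.mem_closure_iff.1 (dense_span_weyl_Omega Ψ) (ε / 2 / (M + 1))
    (by positivity)
  filter_upwards [Metric.tendsto_nhds.1 (hspan Φ hΦ) (ε / 2) (by positivity)] with t ht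
  rw [dist_zero_right] at ht ⊢
  have e : (inner ℂ Ψ (v t) : ℂ) = inner ℂ (Ψ - Φ) (v t) + inner ℂ Φ (v t) := by
    rw [← inner_add_left, sub_add_cancel]
  have h1 : ‖(inner ℂ (Ψ - Φ) (v t) : ℂ)‖ ≤ ε / 2 := by
    refine (norm_inner_le_norm _ _).trans ?_
    rw [hnorm, ← dist_eq_norm]
    calc dist Ψ Φ * M ≤ ε / 2 / (M + 1) * (M + 1) := by gcongr; linarith
      _ = ε / 2 := by field_simp
  rw [e]
  exact (norm_add_le _ _).trans_lt (by linarith)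

/-- The matrix element is unchanged by the translations fixing `Ψ`, hence equal to its limit `0`. -/
lemma inner_weyl_waveSpace (lam : ℤˣ) {Ψ : VacuumSpace} (hΨ : Ψ ∈ waveSpace lam) {f : TestFn}
    (hf : charge f ≠ 0) : inner ℂ (vacuumRep (weyl f) Omega) Ψ = 0 := by
  rw [← inner_conj_symm, map_eq_zero]
  refine tendsto_nhds_unique (tendsto_const_nhds.congr fun t => ?_)
    (tendsto_inner_lightlike lam hf Ψ)
  rw [← translationAut_weyl, ← U_vacuumRep_Omega]
  conv_rhs => rw [← hΨ t]
  rw [LinearIsometryEquiv.inner_map_map]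

lemma waveSpace_le_neutralSpace (lam : ℤˣ) : waveSpace lam ≤ neutralSpace := by
  intro Ψ hΨ
  -- `K` is the closed span of the neutral Weyl vectors; it is orthogonal to the charged ones, so the
  -- component of `Ψ` orthogonal to `K` is orthogonal to all Weyl vectors.
  let K : Submodule ℂ VacuumSpace :=
    (Submodule.span ℂ {Φ | ∃ f, charge f = 0 ∧ vacuumRep (weyl f) Omega = Φ}).topologicalClosure
  have hK : K ≤ neutralSpace := by
    refine Submodule.topologicalClosure_mono (Submodule.span_mono ?_)
    rintro _ ⟨f, hf, rfl⟩
    exact ⟨weyl f, StarSubalgebra.le_topologicalClosure _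
      (StarAlgebra.subset_adjoin ℂ _ ⟨f, hf, rfl⟩), rfl⟩
  have : CompleteSpace K := (Submodule.isClosed_topologicalClosure _).completeSpace_coe
  have hmem : ∀ f, charge f = 0 → vacuumRep (weyl f) Omega ∈ K := fun f hf =>
    Submodule.le_topologicalClosure _ (Submodule.subset_span ⟨f, hf, rfl⟩)
  have hperp : ∀ f, charge f ≠ 0 → ∀ Φ ∈ K, inner ℂ (vacuumRep (weyl f) Omega) Φ = 0 := by
    intro f hf Φ hΦ
    have hle : K ≤ (innerSL ℂ (vacuumRep (weyl f) Omega)).ker := by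
      refine Submodule.topologicalClosure_minimal _ (Submodule.span_le.2 ?_)
        (ContinuousLinearMap.isClosed_ker _)
      rintro _ ⟨g, hg, rfl⟩
      exact inner_weyl_weyl_of_charge_ne (by rw [hg]; exact hf.symm)
    exact hle hΦ
  have hzero : Ψ - K.starProjection Ψ = 0 := by
    refine dense_span_weyl_Omega.eq_zero_of_inner_right ℂ fun Φ hΦ => ?_
    induction hΦ using Submodule.span_induction with
    | mem Φ h =>
      obtain ⟨f, rfl⟩ := h
      by_cases hf : charge f = 0
      · exact K.sub_starProjection_mem_orthogonal Ψ _ (hmem f hf)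
      · rw [inner_sub_right, inner_weyl_waveSpace lam hΨ hf,
          hperp f hf _ (K.starProjection_apply_mem Ψ), sub_zero]
    | zero => simp
    | add Φ Φ' _ _ h h' => rw [inner_add_left, h, h', add_zero]
    | smul c Φ _ h => rw [inner_smul_left, h, mul_zero]
  rw [sub_eq_zero.1 hzero]
  exact hK (K.starProjection_apply_mem Ψ)

end MasslessField

/-- Single-wave vectors of the massless free field on two-dimensional Minkowski spacetime are
neutral: in the GNS representation of the vacuum, the vectors invariant under the lightlike
translations `U(t, λ t)` lie in the neutral subspace, hence are orthogonal to all vectors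
`π(W(f)) Ω` of nonzero charge. Moreover the matrix elements of the lightlike translations between
Weyl vectors vanish if the charges do not add up to zero, and otherwise behave like the power
`|t| ^ (q_f q_g / (4 π))` for large times. -/
theorem mainTheorem2 (lam : ℤˣ) :
    MasslessField.waveSpace lam ≤ MasslessField.neutralSpace ∧
    (∀ Ψ ∈ MasslessField.waveSpace lam, ∀ f : MasslessField.TestFn, MasslessField.charge f ≠ 0 →
      inner ℂ (MasslessField.vacuumRep (MasslessField.weyl f) MasslessField.Omega) Ψ = 0) ∧
    (∀ f g : MasslessField.TestFn, MasslessField.charge f + MasslessField.charge g ≠ 0 →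
      ∀ t : ℝ, inner ℂ MasslessField.Omega
        (MasslessField.vacuumRep (MasslessField.weyl g) (MasslessField.vacuumRep
          (MasslessField.weyl (MasslessField.translate (t, ((lam : ℤ) : ℝ) * t) f))
            MasslessField.Omega)) = 0) ∧
    (∀ f g : MasslessField.TestFn, MasslessField.charge f + MasslessField.charge g = 0 →
      Asymptotics.IsTheta (Filter.atBot ⊔ Filter.atTop)
        (fun t : ℝ => inner ℂ MasslessField.Omega
          (MasslessField.vacuumRep (MasslessField.weyl g) (MasslessField.vacuumRep
            (MasslessField.weyl (MasslessField.translate (t, ((lam : ℤ) : ℝ) * t) f))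
              MasslessField.Omega)))
        (fun t : ℝ => |t| ^
          (MasslessField.charge f * MasslessField.charge g / (4 * Real.pi)))) := by
  open MasslessField in
  exact ⟨waveSpace_le_neutralSpace lam, fun _ hΨ _ hf => inner_weyl_waveSpace lam hΨ hf,
    fun _ _ hq t => inner_lightlike_eq_zero lam hq t, fun _ _ hq => isTheta_inner_lightlike lam hq⟩
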